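/- **Setting.** Let $S\subseteq\mathbb R^D$, $x\in S$, and fix $\pi_1\in(0,1)$, $\pi_0=1-\pi_1$, $L>0$, $\alpha\in(0,1)$ and $\beta\in(0,1-\alpha)$. For probability measures $P_0,P_1$ on $\mathbb R^D$ let $(X_1,Y_1),\dots,(X_n,Y_n)$ be i.i.d. with law $\pi_0[P_0\times\delta_0]+\pi_1[P_1\times\delta_1]$; write $P_X=\pi_0P_0+\pi_1P_1$ for the law of $X$, assume that it is carried by $S$, and let $m(z)=\mathbb P(Y=1\mid X=z)\in[0,1]$ be the regression function (any version; with densities, $m=\pi_1f_1/(\pi_1f_1+\pi_0f_0)$). Let $\mathcal M_0$ be the class of pairs $(P_0,P_1)$ with $m=\pi_1$ on $S$. For $\delta\ge 0$ let $\mathcal M_{Lip}(\delta)$ be the class of pairs for which $|m(y)-m(z)|\le L\|y-z\|_2$ for all $y,z\in S$ and $(m(x)-\pi_1)^2\ge\delta$. For a regression estimate $\widehat m(x)$ put $\widehat{\mathcal T}(x)=(\widehat m(x)-\widehat\pi_1)^2$ with $\widehat\pi_1=\frac1n\sum_iI(Y_i=1)$, and let $t_\alpha$ be the upper $\alpha$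 quantile of the permutation distribution of $\widehat{\mathcal T}(x)$, i.e. the least $t$ such that at most a fraction $\alpha$ of the $n!$ permutations of the labels gives a value of the statistic larger than $t$. The test rejects if $\widehat{\mathcal T}(x)>t_\alpha$. The kNN estimate is the mean of the labels of the $k_n$ observations nearest to $x$ (ties broken by index). The kernel estimate is $\sum_iY_iK(\frac{x-X_i}{h_n})/\sum_iK(\frac{x-X_i}{h_n})$ (with $0/0=0$), where $K$ is measurable and $\lambda I(\|u\|_2\le\rho)\le K(u)\le I(\|u\|_2\le R)$ for some $0<\rho<R$ and $0<\lambda<1$. Write $B_{x,s}$ for the closed ball of radius $s$ about $x$. **Assumption.** Let $r,C,\tau>0$ and $1\le d<D$, and let $\mathcal H$ be the class of pairs $(P_0,P_1)$ as above for which $P_X$ is $(C,d)$-homogeneous on $B_{x,r}$, that is, $P_X(B_{x,r'})\le C\epsilon^{-d}P_X(B_{x,\epsilon r'})$ for all $0<r'\le r$ and $0<\epsilon<1$, and $P_X(B_{x,r})\ge\tau$. **Proposition.** For the kNN test with $k_n=n^{2/(2+d)}$ (rounded up or down to an integer), there exist positive constants $C_{1,x}$ and $N_x$ such that * Type I error: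 $\sup_{\mathcal M_0}\mathbb P_{P_0,P_1}(\widehat{\mathcal T}_{kNN}(x)>t_{\alpha,kNN})\le\alpha$ for every $n$, and * Type II error: $\sup_{n\ge N_x}\ \sup_{\mathcal M_{Lip}(C_{1,x}n^{-2/(2+d)})\cap\mathcal H}\mathbb P_{P_0,P_1}(\widehat{\mathcal T}_{kNN}(x)\le t_{\alpha,kNN})\le\beta$. For the kernel test with $h_n=n^{-1/(2+d)}$, there exist positive constants $C_{1,x}$ and $N_x$ such that * Type I error: $\sup_{\mathcal M_0}\mathbb P_{P_0,P_1}(\widehat{\mathcal T}_{ker}(x)>t_{\alpha,ker})\le\alpha$ for every $n$, and * Type II error: $\sup_{n\ge N_x}\ \sup_{\mathcal M_{Lip}(C_{1,x}n^{-2/(2+d)})\cap\mathcal H}\mathbb P_{P_0,P_1}(\widehat{\mathcal T}_{ker}(x)\le t_{\alpha,ker})\le\beta$. The separation rate $n^{-2/(2+d)}$ thus involves the intrinsic dimension $d$ and not $D$. -/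

import Mathlib

open MeasureTheory

noncomputable section

namespace LocalRegressionTest

variable {E : Type*} [NormedAddCommGroup E] [NormedSpace ℝ E] [MeasurableSpace E]

/-- The marginal law `P_X = π₀ P₀ + π₁ P₁` of the covariate `X`, where `π₀ = 1 - π₁`. -/
def marginalLaw (π₁ : ℝ) (P₀ P₁ : Measure E) : Measure E :=
  ENNReal.ofReal (1 - π₁) • P₀ + ENNReal.ofReal π₁ • P₁

/-- The joint law `π₀ [P₀ × δ₀] + π₁ [P₁ × δ₁]` of one labelled observation `(X, Y)`. The label
`Y` is real valued, and it is almost surely `0` or `1`. -/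
def jointLaw (π₁ : ℝ) (P₀ P₁ : Measure E) : Measure (E × ℝ) :=
  ENNReal.ofReal (1 - π₁) • P₀.prod (Measure.dirac (0 : ℝ)) +
    ENNReal.ofReal π₁ • P₁.prod (Measure.dirac (1 : ℝ))

/-- The law of an i.i.d. sample `(X₁, Y₁), …, (Xₙ, Yₙ)` from the joint law. -/
def sampleLaw (n : ℕ) (π₁ : ℝ) (P₀ P₁ : Measure E) : Measure (Fin n → E × ℝ) :=
  Measure.pi fun _ => jointLaw π₁ P₀ P₁

/-- `m` is a regression function of the pair `(P₀, P₁)`, that is, a version of the conditional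
probability `x ↦ P(Y = 1 | X = x)`. If `P₀` and `P₁` have densities `f₀` and `f₁` with respect to
a common measure, then `m = π₁ f₁ / (π₁ f₁ + π₀ f₀)` is such a function. -/
structure IsRegressionFunction (π₁ : ℝ) (P₀ P₁ : Measure E) (m : E → ℝ) : Prop where
  measurable : Measurable m
  mem_Icc : ∀ z, m z ∈ Set.Icc (0 : ℝ) 1
  setIntegral_eq : ∀ A : Set E, MeasurableSet A →
    ∫ z in A, m z ∂(marginalLaw π₁ P₀ P₁) = (jointLaw π₁ P₀ P₁).real (A ×ˢ {(1 : ℝ)})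

/-- The null class `M₀`: regression functions that equal the class probability on `S`. -/
def nullClass (S : Set E) (π₁ : ℝ) : Set (E → ℝ) :=
  {m | ∀ z ∈ S, m z = π₁}

/-- The class `M_Lip` of functions that are `L`-Lipschitz on `S`. -/
def lipschitzClass (S : Set E) (L : ℝ) : Set (E → ℝ) :=
  {m | ∀ y ∈ S, ∀ z ∈ S, |m y - m z| ≤ L * ‖y - z‖}

/-- The Lipschitz local alternatives `M_Lip(δ)` at the point `x`. -/
def lipschitzAlternatives (S : Set E) (L π₁ : ℝ) (x : E) (δ : ℝ) : Set (E → ℝ) :=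
  {m | m ∈ lipschitzClass S L ∧ δ ≤ (m x - π₁) ^ 2}

/-- The measure `P` is `(C, d)`-homogeneous on the ball `B_{x,r}`. Balls are closed. -/
def IsHomogeneousOnBall (P : Measure E) (C d : ℝ) (x : E) (r : ℝ) : Prop :=
  ∀ r' : ℝ, 0 < r' → r' ≤ r → ∀ ε : ℝ, 0 < ε → ε < 1 →
    P.real (Metric.closedBall x r') ≤ C * ε ^ (-d) * P.real (Metric.closedBall x (ε * r'))

/-- The `k`-nearest-neighbour regression estimate at `x`. The permutation `Tuple.sort` lists the
observations by increasing distance to `x`, ties being broken by the smaller index. -/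
def kNNEstimate {n : ℕ} (k : ℕ) (x : E) (X : Fin n → E) (Y : Fin n → ℝ) : ℝ :=
  (∑ i ∈ Finset.univ.filter (fun i : Fin n => (i : ℕ) < k),
    Y (Tuple.sort (fun j => ‖X j - x‖) i)) / k

/-- The kernel regression estimate at `x` with kernel `K` and bandwidth `h`. It is `0` if all the
kernel weights vanish. -/
def kernelEstimate {n : ℕ} (K : E → ℝ) (h : ℝ) (x : E) (X : Fin n → E) (Y : Fin n → ℝ) : ℝ :=
  (∑ i, Y i * K (h⁻¹ • (x - X i))) / ∑ i, K (h⁻¹ • (x - X i))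

/-- The empirical class probability: the mean of the labels, which for labels in `{0, 1}` is the
proportion of labels equal to `1`. -/
def empiricalClassProb {n : ℕ} (Y : Fin n → ℝ) : ℝ :=
  (∑ i, Y i) / n

/-- The local test statistic `(m̂(x) - π̂₁)²` of the regression estimate `mhat` at `x`, a function
of the covariates and the labels. -/
def localStatistic {n : ℕ} (mhat : (Fin n → E) → (Fin n → ℝ) → ℝ)
    (X : Fin n → E) (Y : Fin n → ℝ) : ℝ :=
  (mhat X Y - empiricalClassProb Y) ^ 2

/-- The upper `α` quantile of the permutation distribution of the statistic `T` at the data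
`(X, Y)`: the least `t` such that at most a proportion `α` of all the `n!` permutations of the
labels gives a value larger than `t`. -/
def permutationQuantile {n : ℕ} (α : ℝ) (T : (Fin n → E) → (Fin n → ℝ) → ℝ)
    (X : Fin n → E) (Y : Fin n → ℝ) : ℝ :=
  sInf {t : ℝ | (Nat.card {σ : Equiv.Perm (Fin n) // t < T X (Y ∘ σ)} : ℝ) /
    Nat.card (Equiv.Perm (Fin n)) ≤ α}

/-- The permutation test of level `α` based on the regression estimate `mhat` rejects on the
sample `z`: the local statistic exceeds its permutation quantile. -/
def Rejects {n : ℕ} (α : ℝ) (mhat : (Fin n → E) → (Fin n → ℝ) → ℝ) (z : Fin n → E × ℝ) : Prop :=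
  permutationQuantile α (localStatistic mhat) (fun i => (z i).1) (fun i => (z i).2) <
    localStatistic mhat (fun i => (z i).1) (fun i => (z i).2)

/-- The law of `X` is carried by `S`, it is `(C, d)`-homogeneous on `B_{x,r}`, and it gives this
ball a mass of at least `τ`. -/
structure IsHomogeneousModel (S : Set E) (C d : ℝ) (x : E) (r τ π₁ : ℝ) (P₀ P₁ : Measure E) :
    Prop where
  carried : marginalLaw π₁ P₀ P₁ Sᶜ = 0
  homogeneous : IsHomogeneousOnBall (marginalLaw π₁ P₀ P₁) C d x r
  mass : τ ≤ (marginalLaw π₁ P₀ P₁).real (Metric.closedBall x r)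

end LocalRegressionTest

end

/-! Level. If `m = π₁` on `S`, then `P₀ = P₁`, so the labels are i.i.d. and independent of the
covariates, and permuting them preserves the law of the sample. In each orbit of the permutation
group at most a proportion `α` of the members is rejected (`card_rank_le`); averaging over the group
gives `permutation_test_level`.

Power. Both estimates are weighted means `∑ w i * Y i` whose weights depend only on the covariates.
With high probability the weights sum to 1, live on a ball of radius `s₀ * h` about `x`, and satisfy
`∑ w i ^ 2 ≤ B₀ * h ^ 2`. Permuted labels are a sample without replacement, so the permuted
statistic has mean at most `∑ w i ^ 2`, and Markov's inequality bounds its quantile by `B₀ * h ^ 2 /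
α` (`permutationQuantile_le`). On the other side, `m̂(x) - π̂₁` differs from `m x - π₁` by a bias of
at most `L * s₀ * h`, a residual sum with second moment at most `B₀ * h ^ 2`, and the error of
`π̂₁`, which is of order `n^(-1/2)`, hence at most of order `h`. A separation of a large multiple of
`h` therefore forces rejection (`type_two_error_le`).

The intrinsic dimension enters only through the mass of balls: homogeneity gives mass at least of
order `h ^ d` to the ball of radius `h`. With `h = n^(-1/(2+d))` the expected number of covariates
there is at least of order `n * h ^ d = h⁻²`, which is what makes the sum of squared weights of
order `h ^ 2`. -/

noncomputable section

namespace LocalRegressionTest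

/-! ### Upper quantiles of a finite family. -/

section Quantile

variable {ι : Type*} [Finite ι] {f : ι → ℝ} {α : ℝ}

theorem card_subtype_div_card_mono {p q : ι → Prop} (h : ∀ i, p i → q i) :
    (Nat.card {i // p i} : ℝ) / Nat.card ι ≤ (Nat.card {i // q i} : ℝ) / Nat.card ι := by
  gcongr
  exact Nat.card_le_card_of_injective _ (Subtype.map_injective h Function.injective_id)

theorem bddBelow_exceedance [Nonempty ι] (hα : α < 1) :
    BddBelow {t : ℝ | (Nat.card {i // t < f i} : ℝ) / Nat.card ι ≤ α} := by
  obtain ⟨b, hb⟩ := (Set.finite_range f).bddBelow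
  refine ⟨b, fun t ht => ?_⟩
  by_contra! htb
  have hall : ∀ i, t < f i := fun i => htb.trans_le (hb ⟨i, rfl⟩)
  have hcard : Nat.card {i // t < f i} = Nat.card ι :=
    Nat.card_congr (Equiv.subtypeUnivEquiv hall)
  have hpos : (0 : ℝ) < Nat.card ι := by exact_mod_cast Nat.card_pos
  simp only [Set.mem_ofPred_eq, hcard, div_self hpos.ne'] at ht
  linarith

/-- The upper quantile of a finite family lies below `a` iff at most a proportion `α` of the
family is at least `a`. -/
theorem sInf_exceedance_lt_iff [Nonempty ι] (hα₀ : 0 ≤ α) (hα₁ : α < 1) (a : ℝ) :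
    sInf {t : ℝ | (Nat.card {i // t < f i} : ℝ) / Nat.card ι ≤ α} < a ↔
      (Nat.card {i // a ≤ f i} : ℝ) / Nat.card ι ≤ α := by
  constructor
  · intro h
    have hne : {t : ℝ | (Nat.card {i // t < f i} : ℝ) / Nat.card ι ≤ α}.Nonempty := by
      obtain ⟨b, hb⟩ := (Set.finite_range f).bddAbove
      refine ⟨b, ?_⟩
      have : IsEmpty {i // b < f i} := ⟨fun i => (hb ⟨i.1, rfl⟩).not_gt i.2⟩
      simpa using hα₀
    obtain ⟨t, ht, hta⟩ := exists_lt_of_csInf_lt hne h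
    exact (card_subtype_div_card_mono fun i hi => hta.trans_le hi).trans ht
  · intro h
    -- The family is finite, so some `t < a` has no value in `[t, a)`; exceeding this `t` is then
    -- the same as being at least `a`.
    have hev : ∀ᶠ t in nhdsWithin a (Set.Iio a), ∀ i, f i < a → f i < t := by
      refine Filter.eventually_all.2 fun i => ?_
      by_cases hi : f i < a
      · filter_upwards [Ioo_mem_nhdsLT hi] with t ht _ using ht.1
      · exact Filter.Eventually.of_forall fun t h => absurd h hi
    obtain ⟨t, ht, hta⟩ := (hev.and self_mem_nhdsWithin).exists
    refine (csInf_le (bddBelow_exceedance hα₁) ?_).trans_lt hta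
    refine (card_subtype_div_card_mono fun i hi => ?_).trans h
    by_contra! hia
    exact (ht i hia).not_gt hi

/-- Markov's inequality for the uniform distribution on the index set, with `v` as a bound on the
mean. -/
theorem sInf_exceedance_le {ι : Type*} [Fintype ι] [Nonempty ι] {f : ι → ℝ}
    (hα : α < 1) (hf : ∀ i, 0 ≤ f i) {t v : ℝ} (ht : 0 < t)
    (hsum : ∑ i, f i ≤ Nat.card ι * v) (hv : v ≤ α * t) :
    sInf {t : ℝ | (Nat.card {i // t < f i} : ℝ) / Nat.card ι ≤ α} ≤ t := by
  classical
  refine csInf_le (bddBelow_exceedance hα) ?_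
  have hpos : (0 : ℝ) < Nat.card ι := by exact_mod_cast Nat.card_pos
  rw [Set.mem_ofPred_eq, div_le_iff₀ hpos]
  have hcard : (Nat.card {i // t < f i} : ℝ) * t ≤ ∑ i, f i := by
    rw [Nat.card_eq_fintype_card, Fintype.card_subtype, ← nsmul_eq_mul]
    calc _ ≤ ∑ i with t < f i, f i :=
          Finset.card_nsmul_le_sum _ _ _ fun i hi => (Finset.mem_filter.1 hi).2.le
      _ ≤ ∑ i, f i := Finset.sum_le_univ_sum_of_nonneg hf
  refine le_of_mul_le_mul_right ?_ ht
  nlinarith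

end Quantile

/-! ### Weighted sums of permuted labels. -/

section Permutation

variable {n : ℕ}

/-- Negative correlation under sampling without replacement. By symmetry the sum takes the same
value for all `j ≠ i`; since the values over all `j` add up to 0 and the diagonal one is
nonnegative, the common value cannot be positive. -/
theorem sum_perm_mul_nonpos {Z : Fin n → ℝ} (hZ : ∑ i, Z i = 0) {i j : Fin n} (hij : i ≠ j) :
    ∑ σ : Equiv.Perm (Fin n), Z (σ i) * Z (σ j) ≤ 0 := by
  set c : Fin n → ℝ := fun j => ∑ σ : Equiv.Perm (Fin n), Z (σ i) * Z (σ j) with hc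
  have hconst : ∀ k, k ≠ i → c k = c j := by
    intro k hk
    rw [hc]
    dsimp only
    -- Composing `σ` with the transposition of `j` and `k` fixes the image of `i`.
    rw [← Equiv.sum_comp (Equiv.mulRight (Equiv.swap j k))]
    refine Finset.sum_congr rfl fun σ _ => ?_
    simp [Equiv.swap_apply_of_ne_of_ne hij hk.symm]
  have htot : ∑ k, c k = 0 := by
    rw [hc, Finset.sum_comm]
    refine Finset.sum_eq_zero fun σ _ => ?_
    rw [← Finset.mul_sum, Equiv.sum_comp σ Z, hZ, mul_zero]
  by_contra! hpos
  have hnn : ∀ k, 0 ≤ c k := by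
    intro k
    rcases eq_or_ne k i with rfl | hk
    · exact Finset.sum_nonneg fun σ _ => mul_self_nonneg _
    · rw [hconst k hk]
      exact hpos.le
  have := Finset.single_le_sum (fun k _ => hnn k) (Finset.mem_univ j)
  linarith

/-- Second moment of a weighted sum under sampling without replacement. -/
theorem sum_perm_sq_le {Z w : Fin n → ℝ} (hZ : ∑ i, Z i = 0) (hZ₁ : ∀ i, |Z i| ≤ 1)
    (hw : ∀ i, 0 ≤ w i) :
    ∑ σ : Equiv.Perm (Fin n), (∑ i, w i * Z (σ i)) ^ 2 ≤
      Nat.card (Equiv.Perm (Fin n)) * ∑ i, w i ^ 2 := by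
  have hexp : ∑ σ : Equiv.Perm (Fin n), (∑ i, w i * Z (σ i)) ^ 2 =
      ∑ i, ∑ j, w i * w j * ∑ σ : Equiv.Perm (Fin n), Z (σ i) * Z (σ j) := by
    simp_rw [sq, Finset.sum_mul_sum, Finset.mul_sum]
    rw [Finset.sum_comm]
    refine Finset.sum_congr rfl fun i _ => ?_
    rw [Finset.sum_comm]
    refine Finset.sum_congr rfl fun j _ => Finset.sum_congr rfl fun σ _ => by ring
  rw [hexp, Finset.mul_sum]
  refine Finset.sum_le_sum fun i _ => ?_
  calc ∑ j, w i * w j * ∑ σ : Equiv.Perm (Fin n), Z (σ i) * Z (σ j)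
      ≤ ∑ j, if j = i then (Nat.card (Equiv.Perm (Fin n)) : ℝ) * w i ^ 2 else 0 := by
        refine Finset.sum_le_sum fun j _ => ?_
        split_ifs with h
        · subst h
          have : ∑ σ : Equiv.Perm (Fin n), Z (σ j) * Z (σ j) ≤
              Nat.card (Equiv.Perm (Fin n)) := by
            calc _ ≤ ∑ σ : Equiv.Perm (Fin n), (1 : ℝ) :=
                  Finset.sum_le_sum fun σ _ => by
                    rw [← sq, ← sq_abs]
                    exact pow_le_one₀ (abs_nonneg _) (hZ₁ _)
              _ = _ := by simp [Nat.card_eq_fintype_card]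
          nlinarith [mul_nonneg (hw j) (hw j)]
        · exact mul_nonpos_of_nonneg_of_nonpos (mul_nonneg (hw i) (hw j))
            (sum_perm_mul_nonpos hZ (Ne.symm h))
    _ = _ := by simp

theorem empiricalClassProb_comp_perm (Y : Fin n → ℝ) (σ : Equiv.Perm (Fin n)) :
    empiricalClassProb (Y ∘ σ) = empiricalClassProb Y := by
  simp only [empiricalClassProb, Function.comp_apply, Equiv.sum_comp σ Y]

theorem sum_sub_empiricalClassProb (Y : Fin n → ℝ) : ∑ i, (Y i - empiricalClassProb Y) = 0 := by
  rcases Nat.eq_zero_or_pos n with rfl | hn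
  · simp
  · have : (n : ℝ) ≠ 0 := by positivity
    rw [Finset.sum_sub_distrib]
    simp [empiricalClassProb]
    field_simp
    simp

theorem empiricalClassProb_mem_Icc {Y : Fin n → ℝ} (hY : ∀ i, Y i ∈ Set.Icc (0 : ℝ) 1) :
    empiricalClassProb Y ∈ Set.Icc (0 : ℝ) 1 := by
  refine ⟨div_nonneg (Finset.sum_nonneg fun i _ => (hY i).1) n.cast_nonneg, ?_⟩
  refine div_le_one_of_le₀ ?_ n.cast_nonneg
  calc ∑ i, Y i ≤ ∑ i : Fin n, (1 : ℝ) := Finset.sum_le_sum fun i _ => (hY i).2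
    _ = n := by simp

/-- The permutation quantile of a weighted mean of the labels is controlled by the sum of the
squared weights. -/
theorem permutationQuantile_le {E : Type*} {α B t : ℝ} (hα₁ : α < 1)
    {mhat : (Fin n → E) → (Fin n → ℝ) → ℝ} {X : Fin n → E} {w : Fin n → ℝ}
    (hmhat : ∀ Y, mhat X Y = ∑ i, w i * Y i) (hw : ∀ i, 0 ≤ w i) (hw₁ : ∑ i, w i = 1)
    (hw₂ : ∑ i, w i ^ 2 ≤ B) (ht : 0 < t) (hB : B ≤ α * t) {Y : Fin n → ℝ}
    (hY : ∀ i, Y i ∈ Set.Icc (0 : ℝ) 1) :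
    permutationQuantile α (localStatistic mhat) X Y ≤ t := by
  have hp := empiricalClassProb_mem_Icc hY
  set Z : Fin n → ℝ := fun i => Y i - empiricalClassProb Y with hZ
  have hstat : ∀ σ : Equiv.Perm (Fin n), localStatistic mhat X (Y ∘ σ) =
      (∑ i, w i * Z (σ i)) ^ 2 := by
    intro σ
    simp only [localStatistic, empiricalClassProb_comp_perm, hmhat, hZ, mul_sub,
      Finset.sum_sub_distrib, ← Finset.sum_mul, hw₁, one_mul, Function.comp_apply]
  have hsum : ∑ σ : Equiv.Perm (Fin n), localStatistic mhat X (Y ∘ σ) ≤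
      Nat.card (Equiv.Perm (Fin n)) * B := by
    rw [Finset.sum_congr rfl fun σ _ => hstat σ]
    refine (sum_perm_sq_le (sum_sub_empiricalClassProb Y)
      (fun i => abs_sub_le_of_nonneg_of_le (hY i).1 (hY i).2 hp.1 hp.2) hw).trans ?_
    exact mul_le_mul_of_nonneg_left hw₂ (Nat.cast_nonneg _)
  exact sInf_exceedance_le hα₁ (fun σ => sq_nonneg _) ht hsum hB

theorem rejects_iff {E : Type*} {α : ℝ} (hα₀ : 0 ≤ α) (hα₁ : α < 1)
    (mhat : (Fin n → E) → (Fin n → ℝ) → ℝ) (z : Fin n → E × ℝ) :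
    Rejects α mhat z ↔
      (Nat.card {σ : Equiv.Perm (Fin n) //
        localStatistic mhat (fun i => (z i).1) (fun i => (z i).2) ≤
          localStatistic mhat (fun i => (z i).1) ((fun i => (z i).2) ∘ σ)} : ℝ) /
        Nat.card (Equiv.Perm (Fin n)) ≤ α :=
  sInf_exceedance_lt_iff hα₀ hα₁ _

end Permutation

/-! ### One labelled observation and its regression function. -/

section JointLaw

variable {F : Type*} [MeasurableSpace F] {π₁ : ℝ} {P₀ P₁ : Measure F}

theorem ofReal_one_sub_add_ofReal (hπ₁ : π₁ ∈ Set.Icc (0 : ℝ) 1) :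
    ENNReal.ofReal (1 - π₁) + ENNReal.ofReal π₁ = 1 := by
  rw [← ENNReal.ofReal_add (by linarith [hπ₁.2]) hπ₁.1]
  simp

theorem map_fst_jointLaw : (jointLaw π₁ P₀ P₁).map Prod.fst = marginalLaw π₁ P₀ P₁ := by
  simp [jointLaw, marginalLaw, Measure.map_add _ _ measurable_fst, Measure.map_smul]

theorem integral_fst_jointLaw {f : F → ℝ} (hf : Measurable f) :
    ∫ z, f z.1 ∂(jointLaw π₁ P₀ P₁) = ∫ y, f y ∂(marginalLaw π₁ P₀ P₁) := by
  rw [← map_fst_jointLaw, integral_map measurable_fst.aemeasurable hf.aestronglyMeasurable]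

theorem ae_label_jointLaw : ∀ᵐ z ∂(jointLaw π₁ P₀ P₁), z.2 ∈ Set.Icc (0 : ℝ) 1 := by
  have hs : MeasurableSet {z : F × ℝ | z.2 ∈ Set.Icc (0 : ℝ) 1} :=
    measurable_snd measurableSet_Icc
  rw [jointLaw, ae_add_measure_iff]
  refine ⟨Measure.ae_smul_measure ?_ _, Measure.ae_smul_measure ?_ _⟩
  · rw [Measure.ae_prod_iff_ae_ae hs]
    exact Filter.Eventually.of_forall fun y => by simp
  · rw [Measure.ae_prod_iff_ae_ae hs]
    exact Filter.Eventually.of_forall fun y => by simp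

theorem ae_mem_jointLaw {S : Set F} (hS : marginalLaw π₁ P₀ P₁ Sᶜ = 0) :
    ∀ᵐ z ∂(jointLaw π₁ P₀ P₁), z.1 ∈ S := by
  have h : ∀ᵐ y ∂(jointLaw π₁ P₀ P₁).map Prod.fst, y ∈ S := by
    rw [map_fst_jointLaw]
    exact hS
  exact ae_of_ae_map measurable_fst.aemeasurable h

theorem jointLaw_real_prod_singleton_one [SFinite P₀] [SFinite P₁]
    (hπ₁ : 0 ≤ π₁) (A : Set F) :
    (jointLaw π₁ P₀ P₁).real (A ×ˢ {(1 : ℝ)}) = π₁ * P₁.real A := by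
  simp [jointLaw, Measure.real, Measure.prod_prod, ENNReal.toReal_ofReal hπ₁]

theorem integral_mul_label_jointLaw [IsProbabilityMeasure P₁] (hπ₁ : π₁ ∈ Set.Icc (0 : ℝ) 1)
    {f : F → ℝ} (hf : Measurable f) {b : ℝ} (hb : ∀ y, |f y| ≤ b) :
    ∫ z, f z.1 * z.2 ∂(jointLaw π₁ P₀ P₁) = π₁ * ∫ y, f y ∂P₁ := by
  have hmeas : Measurable fun z : F × ℝ => f z.1 * z.2 := by fun_prop
  have h0 : ∀ᵐ z ∂(P₀.prod (Measure.dirac (0 : ℝ))), f z.1 * z.2 = 0 := by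
    rw [Measure.ae_prod_iff_ae_ae (measurableSet_eq_fun hmeas measurable_const)]
    refine Filter.Eventually.of_forall fun y => ?_
    rw [ae_dirac_iff (measurableSet_eq_fun (by fun_prop) measurable_const)]
    simp
  have h1 : ∀ᵐ z ∂(P₁.prod (Measure.dirac (1 : ℝ))), f z.1 * z.2 = f z.1 := by
    rw [Measure.ae_prod_iff_ae_ae (measurableSet_eq_fun hmeas (by fun_prop))]
    refine Filter.Eventually.of_forall fun y => ?_
    rw [ae_dirac_iff (measurableSet_eq_fun (by fun_prop) (by fun_prop))]
    simp
  have hint : Integrable (fun z : F × ℝ => f z.1) (P₁.prod (Measure.dirac (1 : ℝ))) :=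
    Integrable.of_bound (hf.comp measurable_fst).aestronglyMeasurable b
      (Filter.Eventually.of_forall fun z => hb z.1)
  rw [jointLaw, integral_add_measure, integral_smul_measure, integral_smul_measure,
    integral_eq_zero_of_ae h0, integral_congr_ae h1, integral_fun_fst,
    ENNReal.toReal_ofReal hπ₁.1]
  · simp
  · exact ((integrable_zero _ _ _).congr (h0.mono fun z hz => hz.symm)).smul_measure
      ENNReal.ofReal_ne_top
  · exact (hint.congr (h1.mono fun z hz => hz.symm)).smul_measure ENNReal.ofReal_ne_top

theorem integral_label_jointLaw [IsProbabilityMeasure P₁] (hπ₁ : π₁ ∈ Set.Icc (0 : ℝ) 1) :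
    ∫ z, z.2 ∂(jointLaw π₁ P₀ P₁) = π₁ := by
  simpa using integral_mul_label_jointLaw (P₀ := P₀) (P₁ := P₁) hπ₁ (f := fun _ => 1)
    measurable_const (b := 1) (by simp)

variable [IsProbabilityMeasure P₀] [IsProbabilityMeasure P₁]

theorem isProbabilityMeasure_marginalLaw (hπ₁ : π₁ ∈ Set.Icc (0 : ℝ) 1) :
    IsProbabilityMeasure (marginalLaw π₁ P₀ P₁) :=
  ⟨by simp [marginalLaw, ofReal_one_sub_add_ofReal hπ₁]⟩

theorem isProbabilityMeasure_jointLaw (hπ₁ : π₁ ∈ Set.Icc (0 : ℝ) 1) :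
    IsProbabilityMeasure (jointLaw π₁ P₀ P₁) :=
  ⟨by simp [jointLaw, ofReal_one_sub_add_ofReal hπ₁]⟩

/-- As an equality of measures, the defining identity on sets extends to integrals of functions of
the covariate. -/
theorem IsRegressionFunction.smul_eq_withDensity {m : F → ℝ} (hπ₁ : π₁ ∈ Set.Icc (0 : ℝ) 1)
    (hm : IsRegressionFunction π₁ P₀ P₁ m) :
    ENNReal.ofReal π₁ • P₁ = (marginalLaw π₁ P₀ P₁).withDensity fun y => ENNReal.ofReal (m y) := by
  have := isProbabilityMeasure_marginalLaw (P₀ := P₀) (P₁ := P₁) hπ₁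
  ext A hA
  have hint : Integrable m (marginalLaw π₁ P₀ P₁) :=
    Integrable.of_bound hm.measurable.aestronglyMeasurable 1
      (Filter.Eventually.of_forall fun y => by
        rw [Real.norm_of_nonneg (hm.mem_Icc y).1]
        exact (hm.mem_Icc y).2)
  rw [withDensity_apply _ hA, ← ofReal_integral_eq_lintegral_ofReal hint.restrict
    (Filter.Eventually.of_forall fun y => (hm.mem_Icc y).1), hm.setIntegral_eq A hA,
    jointLaw_real_prod_singleton_one hπ₁.1, ENNReal.ofReal_mul hπ₁.1]
  simp

/-- The regression residual is orthogonal to every bounded function of the covariate. -/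
theorem IsRegressionFunction.integral_mul_residual {m : F → ℝ} (hπ₁ : π₁ ∈ Set.Icc (0 : ℝ) 1)
    (hm : IsRegressionFunction π₁ P₀ P₁ m) {f : F → ℝ} (hf : Measurable f) {b : ℝ}
    (hb : ∀ y, |f y| ≤ b) : ∫ z, f z.1 * (z.2 - m z.1) ∂(jointLaw π₁ P₀ P₁) = 0 := by
  have hjoint := isProbabilityMeasure_jointLaw (P₀ := P₀) (P₁ := P₁) hπ₁
  have hmm := hm.measurable
  have h1 : ∫ z, f z.1 * m z.1 ∂(jointLaw π₁ P₀ P₁) = π₁ * ∫ y, f y ∂P₁ := by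
    rw [integral_fst_jointLaw (f := fun y => f y * m y) (by fun_prop)]
    have h := congrArg (fun μ => ∫ y, f y ∂μ) (hm.smul_eq_withDensity hπ₁)
    simp only [integral_smul_measure, ENNReal.toReal_ofReal hπ₁.1, smul_eq_mul] at h
    rw [h, integral_withDensity_eq_integral_toReal_smul (by fun_prop)
      (Filter.Eventually.of_forall fun y => ENNReal.ofReal_lt_top)]
    refine integral_congr_ae (Filter.Eventually.of_forall fun y => ?_)
    simp only [ENNReal.toReal_ofReal (hm.mem_Icc y).1, smul_eq_mul]
    ring
  have hi1 : Integrable (fun z : F × ℝ => f z.1 * z.2) (jointLaw π₁ P₀ P₁) := by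
    refine Integrable.of_bound (by fun_prop) b ?_
    filter_upwards [ae_label_jointLaw (π₁ := π₁) (P₀ := P₀) (P₁ := P₁)] with z hz
    rw [norm_mul, Real.norm_of_nonneg hz.1]
    exact (mul_le_of_le_one_right (norm_nonneg _) hz.2).trans (hb z.1)
  have hi2 : Integrable (fun z : F × ℝ => f z.1 * m z.1) (jointLaw π₁ P₀ P₁) := by
    refine Integrable.of_bound (by fun_prop) b (Filter.Eventually.of_forall fun z => ?_)
    rw [norm_mul, Real.norm_of_nonneg (hm.mem_Icc _).1]
    exact (mul_le_of_le_one_right (norm_nonneg _) (hm.mem_Icc _).2).trans (hb z.1)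
  simp_rw [mul_sub]
  rw [integral_sub hi1 hi2, h1, integral_mul_label_jointLaw hπ₁ hf hb, sub_self]

/-- Equal class laws make the label independent of the covariate. -/
theorem jointLaw_self_eq_prod (P : Measure F) [IsProbabilityMeasure P] :
    jointLaw π₁ P P = P.prod (ENNReal.ofReal (1 - π₁) • Measure.dirac (0 : ℝ) +
      ENNReal.ofReal π₁ • Measure.dirac (1 : ℝ)) := by
  rw [Measure.prod_add, Measure.prod_smul_right, Measure.prod_smul_right, jointLaw]

/-- If the regression function is constant, the two class distributions coincide. -/
theorem IsRegressionFunction.eq_of_mem_nullClass {S : Set F} {m : F → ℝ}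
    (hπ₁ : π₁ ∈ Set.Ioo (0 : ℝ) 1) (hS : marginalLaw π₁ P₀ P₁ Sᶜ = 0)
    (hm : IsRegressionFunction π₁ P₀ P₁ m) (hnull : m ∈ nullClass S π₁) : P₀ = P₁ := by
  have hπ : π₁ ∈ Set.Icc (0 : ℝ) 1 := ⟨hπ₁.1.le, hπ₁.2.le⟩
  have hmS : ∀ᵐ y ∂(marginalLaw π₁ P₀ P₁), m y = π₁ := by
    have : ∀ᵐ y ∂(marginalLaw π₁ P₀ P₁), y ∈ S := hS
    exact this.mono hnull
  ext A hA
  have h := hm.setIntegral_eq A hA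
  rw [jointLaw_real_prod_singleton_one hπ.1,
    setIntegral_congr_ae hA (hmS.mono fun y hy _ => hy), setIntegral_const, smul_eq_mul,
    mul_comm] at h
  have h' : (marginalLaw π₁ P₀ P₁).real A = P₁.real A := mul_left_cancel₀ hπ₁.1.ne' h
  have hmarg : (marginalLaw π₁ P₀ P₁).real A = (1 - π₁) * P₀.real A + π₁ * P₁.real A := by
    have h0 : (ENNReal.ofReal (1 - π₁) • P₀) A ≠ ⊤ := by
      simpa using ENNReal.mul_ne_top ENNReal.ofReal_ne_top (measure_ne_top P₀ A)
    have h1 : (ENNReal.ofReal π₁ • P₁) A ≠ ⊤ := by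
      simpa using ENNReal.mul_ne_top ENNReal.ofReal_ne_top (measure_ne_top P₁ A)
    rw [marginalLaw, measureReal_add_apply h0 h1, measureReal_ennreal_smul_apply,
      measureReal_ennreal_smul_apply, ENNReal.toReal_ofReal (by linarith [hπ.2]),
      ENNReal.toReal_ofReal hπ.1]
  have heq : P₀.real A = P₁.real A := by
    have : (1 - π₁) * P₀.real A = (1 - π₁) * P₁.real A := by linarith
    exact mul_left_cancel₀ (by linarith [hπ₁.2]) this
  exact (measureReal_eq_measureReal_iff).1 heq

end JointLaw

/-! ### Level of a permutation test. -/

section Level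

/-- At most a proportion `α` of a finite family lies among its `α`-largest members. -/
theorem card_rank_le {ι : Type*} [Finite ι] {f : ι → ℝ} {α : ℝ} (hα : 0 ≤ α) :
    (Nat.card {i // (Nat.card {j // f i ≤ f j} : ℝ) / Nat.card ι ≤ α} : ℝ) / Nat.card ι ≤ α := by
  rcases isEmpty_or_nonempty {i // (Nat.card {j // f i ≤ f j} : ℝ) / Nat.card ι ≤ α} with h | h
  · simpa using hα
  · obtain ⟨⟨i, hi⟩, hmin⟩ := Finite.exists_min
      fun i : {i // (Nat.card {j // f i ≤ f j} : ℝ) / Nat.card ι ≤ α} => f i.1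
    -- All members of the set have values at least that of its smallest member `i`, and at most a
    -- proportion `α` of the family does.
    exact (card_subtype_div_card_mono fun j hj => hmin ⟨j, hj⟩).trans hi

variable {F : Type*} [MeasurableSpace F] {n : ℕ} {α : ℝ}

theorem measurable_localStatistic {mhat : (Fin n → F) → (Fin n → ℝ) → ℝ}
    (hmhat : Measurable fun p : (Fin n → F) × (Fin n → ℝ) => mhat p.1 p.2) :
    Measurable fun p : (Fin n → F) × (Fin n → ℝ) => localStatistic mhat p.1 p.2 := by
  unfold localStatistic empiricalClassProb
  fun_prop

theorem measurePreserving_permute_labels (μ : Measure (Fin n → F)) [SFinite μ] (ν : Measure ℝ)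
    [SigmaFinite ν] (σ : Equiv.Perm (Fin n)) :
    MeasurePreserving (fun p : (Fin n → F) × (Fin n → ℝ) => (p.1, p.2 ∘ σ))
      (μ.prod (Measure.pi fun _ => ν)) (μ.prod (Measure.pi fun _ => ν)) := by
  have h := measurePreserving_piCongrLeft (fun _ : Fin n => ν) σ.symm
  have h' : MeasurePreserving (fun Y : Fin n → ℝ => Y ∘ σ) (Measure.pi fun _ => ν)
      (Measure.pi fun _ => ν) := by
    convert h using 1
    ext Y i
    simp [MeasurableEquiv.coe_piCongrLeft, Equiv.piCongrLeft, Equiv.piCongrLeft']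
  exact (MeasurePreserving.id μ).prod h'

/-- A permutation test has level `α` whenever the labels are independent of the covariates. -/
theorem permutation_test_level (hα₀ : 0 ≤ α) (hα₁ : α < 1) {mhat : (Fin n → F) → (Fin n → ℝ) → ℝ}
    (hmhat : Measurable fun p : (Fin n → F) × (Fin n → ℝ) => mhat p.1 p.2)
    (P : Measure F) [IsProbabilityMeasure P] (ν : Measure ℝ) [IsProbabilityMeasure ν] :
    (Measure.pi fun _ : Fin n => P.prod ν).real {z | Rejects α mhat z} ≤ α := by
  set T : (Fin n → F) × (Fin n → ℝ) → ℝ := fun p => localStatistic mhat p.1 p.2 with hT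
  have hTm : Measurable T := measurable_localStatistic hmhat
  set N : ℝ := (Nat.card (Equiv.Perm (Fin n)) : ℝ) with hN
  have hNpos : 0 < N := by
    rw [hN]
    exact_mod_cast Nat.card_pos
  set g : Equiv.Perm (Fin n) → (Fin n → F) × (Fin n → ℝ) → (Fin n → F) × (Fin n → ℝ) :=
    fun σ p => (p.1, p.2 ∘ σ) with hg
  set μ := (Measure.pi fun _ : Fin n => P).prod (Measure.pi fun _ : Fin n => ν) with hμ
  have hgm : ∀ σ, MeasurePreserving (g σ) μ μ := fun σ =>
    measurePreserving_permute_labels _ ν σ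
  set A : Set ((Fin n → F) × (Fin n → ℝ)) :=
    {p | (Nat.card {σ // T p ≤ T (g σ p)} : ℝ) / N ≤ α} with hA
  have hAm : MeasurableSet A := by
    have hcard : ∀ p, (Nat.card {σ // T p ≤ T (g σ p)} : ℝ) =
        ∑ σ, if T p ≤ T (g σ p) then (1 : ℝ) else 0 := by
      intro p
      rw [Nat.card_eq_fintype_card, Fintype.card_subtype, Finset.sum_boole]
    simp only [hA, hcard]
    refine measurableSet_le (Measurable.div_const (Finset.measurable_sum _ fun σ _ =>
      Measurable.ite (measurableSet_le hTm (hTm.comp (hgm σ).measurable)) ?_ ?_) _) ?_ <;>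
    exact measurable_const
  have hpre : {z | Rejects α mhat z} =
      MeasurableEquiv.arrowProdEquivProdArrow F ℝ (Fin n) ⁻¹' A := by
    ext z
    exact rejects_iff hα₀ hα₁ mhat z
  have hsample : (Measure.pi fun _ : Fin n => P.prod ν).real {z | Rejects α mhat z} = μ.real A := by
    rw [hpre]
    exact (measurePreserving_arrowProdEquivProdArrow F ℝ (Fin n) (fun _ => P)
      (fun _ => ν)).measureReal_preimage hAm.nullMeasurableSet
  -- Pointwise bound on one orbit: membership of `g σ p` in `A` depends on the rank of its statistic
  -- within the orbit of `p`, because left multiplication by `σ` only reindexes the orbit.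
  have hpoint : ∀ p, ∑ σ, A.indicator (fun _ => (1 : ℝ)) (g σ p) ≤ α * N := by
    intro p
    have hmem : ∀ σ, g σ p ∈ A ↔
        (Nat.card {τ // T (g σ p) ≤ T (g τ p)} : ℝ) / N ≤ α := by
      intro σ
      have : Nat.card {τ // T (g σ p) ≤ T (g τ (g σ p))} =
          Nat.card {τ // T (g σ p) ≤ T (g τ p)} :=
        Nat.card_congr ((Equiv.mulLeft σ).subtypeEquiv fun τ => by
          simp only [hg, Equiv.coe_mulLeft, Equiv.Perm.coe_mul, Function.comp_assoc])
      simp only [hA, Set.mem_ofPred_eq, this]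
    classical
    have hrank := card_rank_le (f := fun σ => T (g σ p)) hα₀
    rw [div_le_iff₀ hNpos] at hrank
    refine le_of_eq_of_le ?_ hrank
    rw [Nat.card_eq_fintype_card, Fintype.card_subtype, ← Finset.sum_boole]
    refine Finset.sum_congr rfl fun σ _ => ?_
    rw [Set.indicator_apply]
    simp only [hmem, hN]
  have hint : ∀ σ, ∫ p, A.indicator (fun _ => (1 : ℝ)) (g σ p) ∂μ = μ.real A := by
    intro σ
    have : (fun p => A.indicator (fun _ => (1 : ℝ)) (g σ p)) =
        (g σ ⁻¹' A).indicator fun _ => (1 : ℝ) := rfl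
    rw [this, integral_indicator_const _ ((hgm σ).measurable hAm),
      (hgm σ).measureReal_preimage hAm.nullMeasurableSet]
    simp
  have hintegrable : ∀ σ, Integrable (fun p => A.indicator (fun _ => (1 : ℝ)) (g σ p)) μ :=
    fun σ => ((integrable_const (1 : ℝ)).indicator ((hgm σ).measurable hAm) :
      Integrable ((g σ ⁻¹' A).indicator fun _ => (1 : ℝ)) μ)
  have hfinal : N * μ.real A ≤ α * N := by
    calc N * μ.real A = ∑ σ, ∫ p, A.indicator (fun _ => (1 : ℝ)) (g σ p) ∂μ := by
          simp only [hint, Finset.sum_const, Finset.card_univ, nsmul_eq_mul, hN,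
            Nat.card_eq_fintype_card]
      _ = ∫ p, ∑ σ, A.indicator (fun _ => (1 : ℝ)) (g σ p) ∂μ :=
          (integral_finsetSum _ fun σ _ => hintegrable σ).symm
      _ ≤ ∫ _, α * N ∂μ :=
          integral_mono (integrable_finsetSum _ fun σ _ => hintegrable σ) (integrable_const _)
            hpoint
      _ = α * N := by simp
  rw [hsample]
  refine le_of_mul_le_mul_left ?_ hNpos
  linarith

theorem type_one_error_le {S : Set F} {π₁ : ℝ} (hπ₁ : π₁ ∈ Set.Ioo (0 : ℝ) 1) (hα₀ : 0 ≤ α)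
    (hα₁ : α < 1) {mhat : (Fin n → F) → (Fin n → ℝ) → ℝ}
    (hmhat : Measurable fun p : (Fin n → F) × (Fin n → ℝ) => mhat p.1 p.2)
    {P₀ P₁ : Measure F} [IsProbabilityMeasure P₀] [IsProbabilityMeasure P₁] {m : F → ℝ}
    (hS : marginalLaw π₁ P₀ P₁ Sᶜ = 0) (hm : IsRegressionFunction π₁ P₀ P₁ m)
    (hnull : m ∈ nullClass S π₁) :
    (sampleLaw n π₁ P₀ P₁).real {z | Rejects α mhat z} ≤ α := by
  obtain rfl := hm.eq_of_mem_nullClass hπ₁ hS hnull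
  have hν : IsProbabilityMeasure (ENNReal.ofReal (1 - π₁) • Measure.dirac (0 : ℝ) +
      ENNReal.ofReal π₁ • Measure.dirac (1 : ℝ)) :=
    ⟨by simp [ofReal_one_sub_add_ofReal ⟨hπ₁.1.le, hπ₁.2.le⟩]⟩
  rw [sampleLaw, jointLaw_self_eq_prod]
  exact permutation_test_level hα₀ hα₁ hmhat P₀ _

end Level

/-! ### Second moments and deviations over an i.i.d. sample. -/

section Moments

open ProbabilityTheory

/-- Fubini, with coordinate `i` integrated innermost. -/
theorem integral_pi_eq_zero_of_integral_update {Ω : Type*} [MeasurableSpace Ω] {n : ℕ}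
    (μ : Measure Ω) [IsProbabilityMeasure μ] (i : Fin n) {f : (Fin n → Ω) → ℝ}
    (hf : Integrable f (Measure.pi fun _ => μ))
    (h : ∀ z, ∫ y, f (Function.update z i y) ∂μ = 0) :
    ∫ z, f z ∂(Measure.pi fun _ => μ) = 0 := by
  obtain _ | n := n
  · exact i.elim0
  have hp := measurePreserving_piFinSuccAbove (fun _ : Fin (n + 1) => μ) i
  have hs := hp.symm
  rw [← hs.integral_comp' f]
  have hint := (hs.integrable_comp_emb (MeasurableEquiv.measurableEmbedding _)).2 hf
  refine (integral_prod_symm _ hint).trans ?_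
  have hne : Nonempty Ω := nonempty_of_isProbabilityMeasure μ
  refine integral_eq_zero_of_ae (Filter.Eventually.of_forall fun z => ?_)
  -- The value inserted in slot `i` is irrelevant: the update overwrites it.
  rw [Pi.zero_apply, ← h (i.insertNth (Classical.arbitrary Ω) z)]
  refine integral_congr_ae (Filter.Eventually.of_forall fun y => ?_)
  simp only [Fin.update_insertNth]
  rfl

/-- The bound uses the second moment of `f`, so for the indicator of a ball it scales with the mass
of the ball. -/
theorem chebyshev_sum_pi {Ω : Type*} [MeasurableSpace Ω] {n : ℕ} (μ : Measure Ω)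
    [IsProbabilityMeasure μ] {f : Ω → ℝ} (hf : MemLp f 2 μ) {v c : ℝ} (hv : ∫ y, f y ^ 2 ∂μ ≤ v)
    (hc : 0 < c) :
    (Measure.pi fun _ : Fin n => μ).real {z | c ≤ |∑ i, f (z i) - n * ∫ y, f y ∂μ|} ≤
      n * v / c ^ 2 := by
  set X : (Fin n → Ω) → ℝ := ∑ i, fun z => f (z i) with hX
  have hXi : ∀ i : Fin n, MemLp (fun z : Fin n → Ω => f (z i)) 2 (Measure.pi fun _ => μ) :=
    fun i => hf.comp_measurePreserving (measurePreserving_eval _ i)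
  have hXm : MemLp X 2 (Measure.pi fun _ => μ) := memLp_finsetSum' _ fun i _ => hXi i
  have hmean : ∫ z, X z ∂(Measure.pi fun _ => μ) = n * ∫ y, f y ∂μ := by
    simp only [hX, Finset.sum_apply]
    rw [integral_finsetSum _ fun i _ => (hXi i).integrable one_le_two]
    have : ∀ i : Fin n, ∫ z, f (z i) ∂(Measure.pi fun _ : Fin n => μ) = ∫ y, f y ∂μ :=
      fun i => integral_comp_eval (μ := fun _ => μ) hf.aestronglyMeasurable
    simp [this]
  have hvar : Var[X; Measure.pi fun _ => μ] ≤ n * v := by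
    rw [hX, variance_sum_pi (X := fun _ => f) fun _ => hf]
    simp only [Finset.sum_const, Finset.card_univ, Fintype.card_fin, nsmul_eq_mul]
    gcongr
    exact (variance_le_expectation_sq hf.aestronglyMeasurable).trans hv
  have hcheb := meas_ge_le_variance_div_sq hXm hc
  rw [hmean] at hcheb
  have hset : {z | c ≤ |∑ i, f (z i) - n * ∫ y, f y ∂μ|} =
      {z | c ≤ |X z - n * ∫ y, f y ∂μ|} := by
    simp [hX]
  rw [hset, Measure.real]
  refine (ENNReal.toReal_mono ENNReal.ofReal_ne_top hcheb).trans ?_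
  rw [ENNReal.toReal_ofReal (div_nonneg (variance_nonneg _ _) (sq_nonneg _))]
  gcongr

variable {F : Type*} [MeasurableSpace F] {π₁ : ℝ} {P₀ P₁ : Measure F}
  [IsProbabilityMeasure P₀] [IsProbabilityMeasure P₁] {n : ℕ}

theorem ae_sampleLaw {p : F × ℝ → Prop} (hπ₁ : π₁ ∈ Set.Icc (0 : ℝ) 1)
    (h : ∀ᵐ y ∂(jointLaw π₁ P₀ P₁), p y) : ∀ᵐ z ∂(sampleLaw n π₁ P₀ P₁), ∀ i, p (z i) := by
  have := isProbabilityMeasure_jointLaw (P₀ := P₀) (P₁ := P₁) hπ₁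
  exact Filter.eventually_all.2 fun i =>
    Measure.tendsto_eval_ae_ae.eventually h

theorem abs_mul_le_of_sum_sq_le {v : Fin n → ℝ} {B : ℝ} (hB : ∑ i, v i ^ 2 ≤ B) (i j : Fin n) :
    |v i * v j| ≤ B := by
  have hi := (Finset.single_le_sum (fun k _ => sq_nonneg (v k)) (Finset.mem_univ i)).trans hB
  have hj := (Finset.single_le_sum (fun k _ => sq_nonneg (v k)) (Finset.mem_univ j)).trans hB
  rw [abs_le]
  constructor <;> nlinarith [sq_nonneg (v i - v j), sq_nonneg (v i + v j)]

/-- Second moment of a sum of the residuals, with weights that depend on all the covariates. -/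
theorem IsRegressionFunction.integral_sq_sum_residual_le {m : F → ℝ}
    (hπ₁ : π₁ ∈ Set.Icc (0 : ℝ) 1) (hm : IsRegressionFunction π₁ P₀ P₁ m)
    {w : (Fin n → F) → Fin n → ℝ} (hw : ∀ i, Measurable fun X => w X i) {B : ℝ}
    (hB : ∀ X, ∑ i, w X i ^ 2 ≤ B) :
    Integrable (fun z => (∑ i, w (fun j => (z j).1) i * ((z i).2 - m (z i).1)) ^ 2)
        (sampleLaw n π₁ P₀ P₁) ∧
      ∫ z, (∑ i, w (fun j => (z j).1) i * ((z i).2 - m (z i).1)) ^ 2 ∂(sampleLaw n π₁ P₀ P₁) ≤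
        B := by
  have hjoint := isProbabilityMeasure_jointLaw (P₀ := P₀) (P₁ := P₁) hπ₁
  have hsample : IsProbabilityMeasure (sampleLaw n π₁ P₀ P₁) := by
    unfold sampleLaw
    infer_instance
  have hmm := hm.measurable
  set ε : F × ℝ → ℝ := fun y => y.2 - m y.1 with hε
  have hεm : Measurable ε := by fun_prop
  set W : (Fin n → F × ℝ) → Fin n → ℝ := fun z => w fun j => (z j).1 with hW
  have hWm : ∀ i, Measurable fun z => W z i := fun i => (hw i).comp (by fun_prop)
  have hεb : ∀ᵐ z ∂(sampleLaw n π₁ P₀ P₁), ∀ i, |ε (z i)| ≤ 1 :=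
    (ae_sampleLaw hπ₁ ae_label_jointLaw).mono fun z hz i =>
      abs_sub_le_of_nonneg_of_le (hz i).1 (hz i).2 (hm.mem_Icc _).1 (hm.mem_Icc _).2
  have hint : ∀ i j, Integrable (fun z => W z i * W z j * (ε (z i) * ε (z j)))
      (sampleLaw n π₁ P₀ P₁) := by
    intro i j
    have h1 := hWm i
    have h2 := hWm j
    refine Integrable.of_bound (Measurable.aestronglyMeasurable (by fun_prop)) B ?_
    filter_upwards [hεb] with z hz
    rw [Real.norm_eq_abs, abs_mul, abs_mul (ε _)]
    have hb := abs_mul_le_of_sum_sq_le (hB fun j => (z j).1) i j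
    exact (mul_le_of_le_one_right (abs_nonneg _)
      (mul_le_one₀ (hz i) (abs_nonneg _) (hz j))).trans hb
  -- With all observations but the `i`-th frozen, the label `i` occurs only in its own residual and
  -- the remaining factors form a bounded function of covariate `i`, so orthogonality of the
  -- residual applies. Both weights may depend on that covariate.
  have hoff : ∀ i j, i ≠ j →
      ∫ z, W z i * W z j * (ε (z i) * ε (z j)) ∂(sampleLaw n π₁ P₀ P₁) = 0 := by
    intro i j hij
    refine integral_pi_eq_zero_of_integral_update _ i (hint i j) fun z => ?_
    set U : F → Fin n → F := fun e => Function.update (fun k => (z k).1) i e with hU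
    have hWU : ∀ y : F × ℝ, W (Function.update z i y) = w (U y.1) := by
      intro y
      simp only [hW, hU]
      congr 1
      ext k
      rcases eq_or_ne k i with rfl | hk
      · simp
      · simp [hk]
    have hUm : Measurable U := measurable_update _
    have h1 := (hw i).comp hUm
    have h2 := (hw j).comp hUm
    have key := hm.integral_mul_residual hπ₁
      (f := fun e => w (U e) i * w (U e) j * ε (z j)) ((h1.mul h2).mul_const _)
      (b := B * |ε (z j)|) fun e => by
        rw [abs_mul]
        exact mul_le_mul_of_nonneg_right (abs_mul_le_of_sum_sq_le (hB _) i j) (abs_nonneg _)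
    rw [← key]
    refine integral_congr_ae (Filter.Eventually.of_forall fun y => ?_)
    simp only [hWU, Function.update_self, Function.update_of_ne hij.symm]
    ring
  have hexp : ∀ z, (∑ i, W z i * ε (z i)) ^ 2 =
      ∑ i, ∑ j, W z i * W z j * (ε (z i) * ε (z j)) := by
    intro z
    rw [sq, Finset.sum_mul_sum]
    exact Finset.sum_congr rfl fun i _ => Finset.sum_congr rfl fun j _ => by ring
  change Integrable (fun z => (∑ i, W z i * ε (z i)) ^ 2) _ ∧
    ∫ z, (∑ i, W z i * ε (z i)) ^ 2 ∂_ ≤ B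
  simp only [hexp]
  refine ⟨integrable_finsetSum _ fun i _ => integrable_finsetSum _ fun j _ => hint i j, ?_⟩
  rw [integral_finsetSum _ fun i _ => integrable_finsetSum _ fun j _ => hint i j]
  calc ∑ i, ∫ z, ∑ j, W z i * W z j * (ε (z i) * ε (z j)) ∂(sampleLaw n π₁ P₀ P₁)
      = ∑ i, ∫ z, W z i * W z i * (ε (z i) * ε (z i)) ∂(sampleLaw n π₁ P₀ P₁) := by
        refine Finset.sum_congr rfl fun i _ => ?_
        rw [integral_finsetSum _ fun j _ => hint i j]
        exact Finset.sum_eq_single_of_mem i (Finset.mem_univ i) fun j _ hj => hoff i j hj.symm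
    _ = ∫ z, ∑ i, W z i * W z i * (ε (z i) * ε (z i)) ∂(sampleLaw n π₁ P₀ P₁) :=
        (integral_finsetSum _ fun i _ => hint i i).symm
    _ ≤ ∫ _, B ∂(sampleLaw n π₁ P₀ P₁) := by
        refine integral_mono_ae (integrable_finsetSum _ fun i _ => hint i i)
          (integrable_const _) ?_
        filter_upwards [hεb] with z hz
        refine (Finset.sum_le_sum fun i _ => ?_).trans (hB fun j => (z j).1)
        rw [← sq, ← sq]
        exact mul_le_of_le_one_right (sq_nonneg _) ((sq_le_one_iff_abs_le_one _).2 (hz i))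
    _ = B := by simp

theorem label_sum_deviation_le (hπ₁ : π₁ ∈ Set.Icc (0 : ℝ) 1) {c : ℝ} (hc : 0 < c) :
    (sampleLaw n π₁ P₀ P₁).real {z | c ≤ |∑ i, (z i).2 - n * π₁|} ≤ n / c ^ 2 := by
  have := isProbabilityMeasure_jointLaw (P₀ := P₀) (P₁ := P₁) hπ₁
  have hb : ∀ᵐ z ∂(jointLaw π₁ P₀ P₁), ‖z.2‖ ≤ 1 :=
    ae_label_jointLaw.mono fun z hz => by
      rw [Real.norm_of_nonneg hz.1]
      exact hz.2
  have hL2 : MemLp (fun z : F × ℝ => z.2) 2 (jointLaw π₁ P₀ P₁) :=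
    MemLp.of_bound (by fun_prop) 1 hb
  have h := chebyshev_sum_pi (n := n) (jointLaw π₁ P₀ P₁) hL2 (v := 1) (c := c) ?_ hc
  · simp only [integral_label_jointLaw hπ₁, mul_one] at h
    exact h
  · calc ∫ z, z.2 ^ 2 ∂(jointLaw π₁ P₀ P₁) ≤ ∫ _, (1 : ℝ) ∂(jointLaw π₁ P₀ P₁) := by
          refine integral_mono_ae hL2.integrable_sq (integrable_const _) (hb.mono fun z hz => ?_)
          exact (sq_le_one_iff_abs_le_one _).2 hz
      _ = 1 := by simp

end Moments

/-! ### Type II error for general local weights. -/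

section Power

variable {F : Type*} [NormedAddCommGroup F] [MeasurableSpace F]
  {π₁ : ℝ} {P₀ P₁ : Measure F} [IsProbabilityMeasure P₀] [IsProbabilityMeasure P₁] {n : ℕ}

/-- The number of covariates in the closed ball of radius `s` about `x`. -/
def ballCount (x : F) (s : ℝ) (X : Fin n → F) : ℝ :=
  ∑ i, (Metric.closedBall x s).indicator (fun _ => (1 : ℝ)) (X i)

theorem measurable_ballCount [OpensMeasurableSpace F] (x : F) (s : ℝ) :
    Measurable (ballCount x s : (Fin n → F) → ℝ) :=
  Finset.measurable_sum _ fun i _ =>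
    (measurable_const.indicator Metric.isClosed_closedBall.measurableSet).comp
      (measurable_pi_apply i)

/-- A count below `q` deviates from its mean by at least half of that mean, and its variance is at
most the mean. -/
theorem ballCount_lt_le [OpensMeasurableSpace F] (hπ₁ : π₁ ∈ Set.Icc (0 : ℝ) 1) {x : F}
    {s q : ℝ} (hq : 0 < q)
    (hmass : 2 * q ≤ n * (marginalLaw π₁ P₀ P₁).real (Metric.closedBall x s)) :
    (sampleLaw n π₁ P₀ P₁).real {z | ballCount x s (fun i => (z i).1) < q} ≤ 2 / q := by
  have := isProbabilityMeasure_jointLaw (P₀ := P₀) (P₁ := P₁) hπ₁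
  set p := (marginalLaw π₁ P₀ P₁).real (Metric.closedBall x s) with hp
  set g : F → ℝ := (Metric.closedBall x s).indicator (fun _ => (1 : ℝ)) with hg
  have hball : MeasurableSet (Metric.closedBall x s) := Metric.isClosed_closedBall.measurableSet
  have hgm : Measurable g := measurable_const.indicator hball
  have hgb : ∀ y, ‖g y‖ ≤ 1 := fun y => (norm_indicator_le_norm_self _ y).trans (by simp)
  have hsq : ∀ y, g y ^ 2 = g y := by
    intro y
    by_cases hy : y ∈ Metric.closedBall x s <;> simp [hg, hy]
  have hmean : ∫ z, g z.1 ∂(jointLaw π₁ P₀ P₁) = p := by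
    rw [integral_fst_jointLaw hgm, hg, integral_indicator_const _ hball]
    simp [hp]
  have hL2 : MemLp (fun z : F × ℝ => g z.1) 2 (jointLaw π₁ P₀ P₁) :=
    MemLp.of_bound (hgm.comp measurable_fst).aestronglyMeasurable 1
      (Filter.Eventually.of_forall fun z => hgb z.1)
  have hnp : 0 < n * p := by linarith
  have hcheb := chebyshev_sum_pi (n := n) (jointLaw π₁ P₀ P₁) hL2 (v := p) (c := n * p / 2)
    (by simp only [hsq, hmean, le_refl]) (by positivity)
  rw [hmean] at hcheb
  calc (sampleLaw n π₁ P₀ P₁).real {z | ballCount x s (fun i => (z i).1) < q}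
      ≤ (sampleLaw n π₁ P₀ P₁).real {z | n * p / 2 ≤ |∑ i, g (z i).1 - n * p|} := by
        have : IsProbabilityMeasure (sampleLaw n π₁ P₀ P₁) := by
          unfold sampleLaw
          infer_instance
        refine measureReal_mono fun z hz => ?_
        have hz' : ∑ i, g (z i).1 < q := hz
        rw [Set.mem_ofPred_eq, le_abs]
        right
        linarith
    _ ≤ n * p / (n * p / 2) ^ 2 := hcheb
    _ = 4 / (n * p) := by field_simp; norm_num
    _ ≤ 4 / (2 * q) := by gcongr
    _ = 2 / q := by field_simp; norm_num

/-- A separation, in units of the bandwidth, at which the permutation test has power. -/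
def separationConstant (L s₀ B₀ α β : ℝ) : ℝ :=
  L * s₀ + √(3 * B₀ / β) + √(3 / β) + √(B₀ / α) + 1

/-- Type II error of the permutation test based on a weighted mean of the labels, whose weights
depend on the covariates and live on a ball of radius `s₀ * h` about `x`. -/
theorem type_two_error_le [OpensMeasurableSpace F] {S : Set F} {x : F}
    {L α β h s s₀ B₀ q : ℝ} (hπ₁ : π₁ ∈ Set.Icc (0 : ℝ) 1) (hα₀ : 0 < α) (hα₁ : α < 1)
    (hβ : 0 < β) (hn : 0 < n) (hx : x ∈ S) (hL : 0 ≤ L) (hh : 0 < h) (hnh : 1 ≤ n * h ^ 2)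
    (hB₀ : 0 < B₀) (hq : 6 / β ≤ q)
    (hmass : 2 * q ≤ n * (marginalLaw π₁ P₀ P₁).real (Metric.closedBall x s))
    {m : F → ℝ} (hS : marginalLaw π₁ P₀ P₁ Sᶜ = 0) (hm : IsRegressionFunction π₁ P₀ P₁ m)
    (hLip : m ∈ lipschitzClass S L) (hsep : separationConstant L s₀ B₀ α β * h ≤ |m x - π₁|)
    {mhat : (Fin n → F) → (Fin n → ℝ) → ℝ} {w : (Fin n → F) → Fin n → ℝ}
    (hwm : ∀ i, Measurable fun X => w X i) (hw₀ : ∀ X i, 0 ≤ w X i)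
    (hmhat : ∀ X Y, mhat X Y = ∑ i, w X i * Y i)
    (hw₁ : ∀ X, q ≤ ballCount x s X → ∑ i, w X i = 1)
    (hw₂ : ∀ X, q ≤ ballCount x s X → ∑ i, w X i ^ 2 ≤ B₀ * h ^ 2)
    (hws : ∀ X, q ≤ ballCount x s X → ∀ i, w X i ≠ 0 → ‖X i - x‖ ≤ s₀ * h) :
    (sampleLaw n π₁ P₀ P₁).real {z | ¬ Rejects α mhat z} ≤ β := by
  have hjoint := isProbabilityMeasure_jointLaw (P₀ := P₀) (P₁ := P₁) hπ₁
  have hsample : IsProbabilityMeasure (sampleLaw n π₁ P₀ P₁) := by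
    unfold sampleLaw
    infer_instance
  have hn' : (0 : ℝ) < n := by exact_mod_cast hn
  set a := √(3 * B₀ / β) with ha
  set b := √(3 / β) with hb
  have ha2 : a ^ 2 = 3 * B₀ / β := Real.sq_sqrt (by positivity)
  have hb2 : b ^ 2 = 3 / β := Real.sq_sqrt (by positivity)
  have ha0 : 0 < a := Real.sqrt_pos.2 (by positivity)
  have hb0 : 0 < b := Real.sqrt_pos.2 (by positivity)
  set G : Set (Fin n → F) := {X | q ≤ ballCount x s X} with hG
  have hGm : MeasurableSet G := measurableSet_le measurable_const (measurable_ballCount x s)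
  -- Setting the weights to zero off `G` makes the bound on the sum of squares hold for every `X`,
  -- as the second moment estimate requires.
  set w' : (Fin n → F) → Fin n → ℝ := fun X i => G.indicator (fun X => w X i) X with hw'
  have hres := hm.integral_sq_sum_residual_le (n := n) hπ₁ (w := w')
    (fun i => (hwm i).indicator hGm) (B := B₀ * h ^ 2) fun X => by
      by_cases hX : X ∈ G
      · simpa [hw', hX] using hw₂ X hX
      · simp only [hw', Set.indicator_of_notMem hX]
        simp
        positivity
  set R : (Fin n → F × ℝ) → ℝ := fun z =>
    ∑ i, w' (fun j => (z j).1) i * ((z i).2 - m (z i).1) with hR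
  -- The three bad events, each of probability at most `β / 3`: too few covariates in the ball, a
  -- large residual sum, a poor class proportion.
  set A₁ : Set (Fin n → F × ℝ) := {z | ballCount x s (fun i => (z i).1) < q} with hA₁
  set A₂ : Set (Fin n → F × ℝ) := {z | (a * h) ^ 2 ≤ R z ^ 2} with hA₂
  set A₃ : Set (Fin n → F × ℝ) := {z | n * (b * h) ≤ |∑ i, (z i).2 - n * π₁|} with hA₃
  have hP₁ : (sampleLaw n π₁ P₀ P₁).real A₁ ≤ β / 3 := by
    have hq0 : 0 < q := lt_of_lt_of_le (by positivity) hq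
    refine (ballCount_lt_le hπ₁ hq0 hmass).trans ?_
    rw [div_le_div_iff₀ hq0 (by norm_num)]
    rw [div_le_iff₀ hβ] at hq
    linarith
  have hP₂ : (sampleLaw n π₁ P₀ P₁).real A₂ ≤ β / 3 := by
    have hmarkov := mul_meas_ge_le_integral_of_nonneg
      (Filter.Eventually.of_forall fun z => sq_nonneg (R z)) hres.1 ((a * h) ^ 2)
    have hle : (a * h) ^ 2 * (sampleLaw n π₁ P₀ P₁).real A₂ ≤ B₀ * h ^ 2 := hmarkov.trans hres.2
    have hah : (a * h) ^ 2 = 3 * B₀ / β * h ^ 2 := by rw [mul_pow, ha2]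
    rw [hah] at hle
    have hc : 3 * B₀ / β * h ^ 2 * (sampleLaw n π₁ P₀ P₁).real A₂ ≤
        3 * B₀ / β * h ^ 2 * (β / 3) := by
      refine hle.trans (le_of_eq ?_)
      field_simp
    exact le_of_mul_le_mul_left hc (by positivity)
  have hP₃ : (sampleLaw n π₁ P₀ P₁).real A₃ ≤ β / 3 := by
    refine (label_sum_deviation_le hπ₁ (by positivity)).trans ?_
    rw [div_le_iff₀ (by positivity), mul_pow, mul_pow, hb2]
    -- Chebyshev's bound equals `(β / 3) / (n * h ^ 2)`, so `1 ≤ n * h ^ 2` is exactly what is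
    -- needed.
    have : β / 3 * (n ^ 2 * (3 / β * h ^ 2)) = n * (n * h ^ 2) := by
      field_simp
    rw [this]
    exact le_mul_of_one_le_right hn'.le hnh
  have hsub : {z | ¬ Rejects α mhat z} ≤ᵐ[sampleLaw n π₁ P₀ P₁] (A₁ ∪ A₂ ∪ A₃ : Set _) := by
    filter_upwards [ae_sampleLaw (n := n) hπ₁ (ae_mem_jointLaw hS),
      ae_sampleLaw (n := n) hπ₁ (ae_label_jointLaw (P₀ := P₀) (P₁ := P₁))] with z hzS hzY hz
    by_contra hgood
    have hgood' : z ∉ A₁ ∪ A₂ ∪ A₃ := hgood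
    simp only [Set.mem_union, not_or] at hgood'
    obtain ⟨⟨h1, h2⟩, h3⟩ := hgood'
    refine hz ?_
    set X : Fin n → F := fun i => (z i).1 with hX
    set Y : Fin n → ℝ := fun i => (z i).2 with hY
    have hXG : q ≤ ballCount x s X := not_lt.1 h1
    have hsum := hw₁ X hXG
    have hquant : permutationQuantile α (localStatistic mhat) X Y ≤ B₀ * h ^ 2 / α :=
      permutationQuantile_le hα₁ (hmhat X) (hw₀ X) hsum (hw₂ X hXG) (by positivity)
        (le_of_eq (by field_simp)) hzY
    refine hquant.trans_lt ?_
    have hRX : R z = ∑ i, w X i * (Y i - m (X i)) := by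
      refine Finset.sum_congr rfl fun i _ => ?_
      have hwX : w' X i = w X i := Set.indicator_of_mem (show X ∈ G from hXG) _
      rw [← hwX]
    have hRa : |R z| < a * h := by
      refine abs_lt_of_sq_lt_sq (not_le.1 h2) (by positivity)
    have hbias : |∑ i, w X i * (m (X i) - m x)| ≤ L * (s₀ * h) := by
      calc |∑ i, w X i * (m (X i) - m x)| ≤ ∑ i, |w X i * (m (X i) - m x)| :=
            Finset.abs_sum_le_sum_abs _ _
        _ ≤ ∑ i, w X i * (L * (s₀ * h)) := by
            refine Finset.sum_le_sum fun i _ => ?_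
            rw [abs_mul, abs_of_nonneg (hw₀ X i)]
            rcases eq_or_ne (w X i) 0 with hi | hi
            · simp [hi]
            · refine mul_le_mul_of_nonneg_left ((hLip _ (hzS i) _ hx).trans ?_) (hw₀ X i)
              exact mul_le_mul_of_nonneg_left (hws X hXG i hi) hL
        _ = L * (s₀ * h) := by rw [← Finset.sum_mul, hsum, one_mul]
    have hemp : |empiricalClassProb Y - π₁| < b * h := by
      have : empiricalClassProb Y - π₁ = (∑ i, Y i - n * π₁) / n := by
        rw [empiricalClassProb]
        field_simp
      rw [this, abs_div, abs_of_pos hn', div_lt_iff₀ hn', mul_comm (b * h)]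
      exact not_le.1 h3
    have hdecomp : mhat X Y - empiricalClassProb Y = R z +
        ∑ i, w X i * (m (X i) - m x) + (m x - π₁) - (empiricalClassProb Y - π₁) := by
      rw [hmhat, hRX]
      simp only [mul_sub, Finset.sum_sub_distrib, ← Finset.sum_mul, hsum]
      ring
    -- The first three terms of `separationConstant` absorb the bias and the two random errors. The
    -- final `1` makes the comparison with the quantile strict.
    have hlow : (√(B₀ / α) + 1) * h ≤ |mhat X Y - empiricalClassProb Y| := by
      have htri : |m x - π₁| ≤ |mhat X Y - empiricalClassProb Y| + |R z| +
          |∑ i, w X i * (m (X i) - m x)| + |empiricalClassProb Y - π₁| := by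
        have : m x - π₁ = (mhat X Y - empiricalClassProb Y) + -(R z) +
            -(∑ i, w X i * (m (X i) - m x)) + (empiricalClassProb Y - π₁) := by
          rw [hdecomp]
          ring
        rw [this]
        refine (abs_add_le _ _).trans (add_le_add_left ((abs_add_le _ _).trans ?_) _)
        rw [abs_neg]
        refine add_le_add_left ((abs_add_le _ _).trans ?_) _
        rw [abs_neg]
      rw [separationConstant] at hsep
      linarith
    calc B₀ * h ^ 2 / α = (√(B₀ / α) * h) ^ 2 := by
          rw [mul_pow, Real.sq_sqrt (by positivity)]
          ring
      _ < ((√(B₀ / α) + 1) * h) ^ 2 := by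
          gcongr
          linarith
      _ ≤ |mhat X Y - empiricalClassProb Y| ^ 2 := by gcongr
      _ = localStatistic mhat X Y := by rw [sq_abs, localStatistic]
  calc (sampleLaw n π₁ P₀ P₁).real {z | ¬ Rejects α mhat z}
      ≤ (sampleLaw n π₁ P₀ P₁).real (A₁ ∪ A₂ ∪ A₃) :=
        ENNReal.toReal_mono (measure_ne_top _ _) (measure_mono_ae hsub)
    _ ≤ (sampleLaw n π₁ P₀ P₁).real A₁ + (sampleLaw n π₁ P₀ P₁).real A₂ +
        (sampleLaw n π₁ P₀ P₁).real A₃ :=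
        (measureReal_union_le _ _).trans (add_le_add_left (measureReal_union_le _ _) _)
    _ ≤ β := by linarith

end Power

/-! ### Nearest-neighbour weights. -/

section NearestNeighbours

variable {F : Type*} [NormedAddCommGroup F] {n : ℕ}

/-- The weights of the `k`-nearest-neighbour estimate. -/
def kNNWeight (k : ℕ) (x : F) (X : Fin n → F) (j : Fin n) : ℝ :=
  if ((Tuple.sort fun j => ‖X j - x‖).symm j : ℕ) < k then (k : ℝ)⁻¹ else 0

theorem kNNWeight_nonneg (k : ℕ) (x : F) (X : Fin n → F) (j : Fin n) : 0 ≤ kNNWeight k x X j := by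
  unfold kNNWeight
  split_ifs <;> positivity

theorem sum_kNNWeight_mul (k : ℕ) (x : F) (X : Fin n → F) (Y : Fin n → ℝ) :
    ∑ j, kNNWeight k x X j * Y j = kNNEstimate k x X Y := by
  rw [← Equiv.sum_comp (Tuple.sort fun j => ‖X j - x‖), kNNEstimate, Finset.sum_filter,
    Finset.sum_div]
  refine Finset.sum_congr rfl fun i _ => ?_
  simp only [kNNWeight, Equiv.symm_apply_apply]
  split_ifs <;> ring

theorem sum_kNNWeight {k : ℕ} (hk : 0 < k) (hkn : k ≤ n) (x : F) (X : Fin n → F) :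
    ∑ j, kNNWeight k x X j = 1 := by
  have hcard : (Finset.univ.filter fun i : Fin n => (i : ℕ) < k).card = k := by
    rw [Fin.card_filter_val_lt, min_eq_right hkn]
  have h := sum_kNNWeight_mul k x X fun _ => 1
  simp only [mul_one] at h
  rw [h, kNNEstimate, Finset.sum_const, hcard]
  have : (k : ℝ) ≠ 0 := by positivity
  simp [this]

theorem sum_kNNWeight_sq {k : ℕ} (hk : 0 < k) (hkn : k ≤ n) (x : F) (X : Fin n → F) :
    ∑ j, kNNWeight k x X j ^ 2 = (k : ℝ)⁻¹ := by
  have h : ∀ j, kNNWeight k x X j ^ 2 = (k : ℝ)⁻¹ * kNNWeight k x X j := by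
    intro j
    unfold kNNWeight
    split_ifs <;> ring
  simp_rw [h]
  rw [← Finset.mul_sum, sum_kNNWeight hk hkn, mul_one]

/-- If one of the `k` nearest points lay outside the ball, every point of the ball would precede it
in the sorted order, so the ball would contain fewer than `k` points. -/
theorem norm_sub_le_of_kNNWeight_ne_zero {k : ℕ} {x : F} {s : ℝ} {X : Fin n → F}
    (hX : (k : ℝ) ≤ ballCount x s X) {j : Fin n} (hj : kNNWeight k x X j ≠ 0) :
    ‖X j - x‖ ≤ s := by
  classical
  set f : Fin n → ℝ := fun j => ‖X j - x‖ with hf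
  set σ := Tuple.sort f with hσ
  have hjk : (σ.symm j : ℕ) < k := by
    by_contra h
    exact hj (if_neg h)
  by_contra! hjs
  have hcount : ballCount x s X = ((Finset.univ.filter fun i => f i ≤ s).card : ℝ) := by
    rw [ballCount, ← Finset.sum_boole]
    refine Finset.sum_congr rfl fun i _ => ?_
    simp only [Set.indicator_apply, mem_closedBall_iff_norm, hf]
  have hsub : (Finset.univ.filter fun i => f i ≤ s) ⊆
      (Finset.univ.filter fun i : Fin n => (i : ℕ) < σ.symm j).map σ.toEmbedding := by
    intro i hi
    refine Finset.mem_map.2 ⟨σ.symm i, Finset.mem_filter.2 ⟨Finset.mem_univ _, ?_⟩, by simp⟩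
    by_contra! hle
    have hmono := Tuple.monotone_sort f (show σ.symm j ≤ σ.symm i from hle)
    simp only [Function.comp_apply, ← hσ, Equiv.apply_symm_apply] at hmono
    exact absurd ((Finset.mem_filter.1 hi).2) (not_le.2 (hjs.trans_le hmono))
  have hcard := Finset.card_le_card hsub
  rw [Finset.card_map, Fin.card_filter_val_lt] at hcard
  rw [hcount] at hX
  have hX' := Nat.cast_le.1 hX
  omega

variable [MeasurableSpace F] [BorelSpace F]

/-- `Tuple.eq_sort_iff` describes the sorting permutation by finitely many comparisons of distances,
including the tie-breaking rule. -/
theorem measurableSet_sort_eq (x : F) (σ : Equiv.Perm (Fin n)) :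
    MeasurableSet {X : Fin n → F | Tuple.sort (fun j => ‖X j - x‖) = σ} := by
  have hf : ∀ i, Measurable fun X : Fin n → F => ‖X i - x‖ := fun i =>
    (continuous_norm.comp (continuous_id.sub continuous_const)).measurable.comp
      (measurable_pi_apply i)
  have hset : {X : Fin n → F | Tuple.sort (fun j => ‖X j - x‖) = σ} =
      {X | (∀ i j, i ≤ j → ‖X (σ i) - x‖ ≤ ‖X (σ j) - x‖) ∧
        ∀ i j, i < j → ‖X (σ i) - x‖ = ‖X (σ j) - x‖ → σ i < σ j} := by
    ext X
    exact eq_comm.trans Tuple.eq_sort_iff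
  rw [hset, measurableSet_setOfPred]
  refine Measurable.and (Measurable.forall fun i => Measurable.forall fun j => ?_)
    (Measurable.forall fun i => Measurable.forall fun j => ?_)
  · exact measurable_const.imp (measurableSet_setOfPred.1 (measurableSet_le (hf _) (hf _)))
  · exact measurable_const.imp
      ((measurableSet_setOfPred.1 (measurableSet_eq_fun (hf _) (hf _))).imp measurable_const)

theorem measurable_kNNWeight (k : ℕ) (x : F) (j : Fin n) :
    Measurable fun X : Fin n → F => kNNWeight k x X j := by
  have h : (fun X : Fin n → F => kNNWeight k x X j) = fun X =>
      ∑ σ, {X : Fin n → F | Tuple.sort (fun j => ‖X j - x‖) = σ}.indicator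
        (fun _ => if (σ.symm j : ℕ) < k then (k : ℝ)⁻¹ else 0) X := by
    ext X
    simp only [Set.indicator_apply, Set.mem_ofPred_eq, Finset.sum_ite_eq, Finset.mem_univ, if_true]
    rfl
  rw [h]
  exact Finset.measurable_sum _ fun σ _ =>
    measurable_const.indicator (measurableSet_sort_eq x σ)

theorem measurable_kNNEstimate (k : ℕ) (x : F) :
    Measurable fun p : (Fin n → F) × (Fin n → ℝ) => kNNEstimate k x p.1 p.2 := by
  simp only [← sum_kNNWeight_mul]
  exact Finset.measurable_sum _ fun j _ =>
    ((measurable_kNNWeight k x j).comp measurable_fst).mul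
      ((measurable_pi_apply j).comp measurable_snd)

end NearestNeighbours

/-! ### Kernel weights. -/

section Kernel

variable {F : Type*} [NormedAddCommGroup F] [NormedSpace ℝ F] {n : ℕ} {K : F → ℝ}

/-- The weights of the kernel estimate. -/
def kernelWeight (K : F → ℝ) (h : ℝ) (x : F) (X : Fin n → F) (j : Fin n) : ℝ :=
  K (h⁻¹ • (x - X j)) / ∑ i, K (h⁻¹ • (x - X i))

theorem sum_kernelWeight_mul (h : ℝ) (x : F) (X : Fin n → F) (Y : Fin n → ℝ) :
    ∑ j, kernelWeight K h x X j * Y j = kernelEstimate K h x X Y := by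
  rw [kernelEstimate, Finset.sum_div]
  refine Finset.sum_congr rfl fun i _ => ?_
  rw [kernelWeight]
  ring

theorem kernelWeight_nonneg (hK : ∀ u, 0 ≤ K u) (h : ℝ) (x : F) (X : Fin n → F) (j : Fin n) :
    0 ≤ kernelWeight K h x X j :=
  div_nonneg (hK _) (Finset.sum_nonneg fun _ _ => hK _)

theorem norm_inv_smul_sub_le_iff {h : ℝ} (hh : 0 < h) (x y : F) (s : ℝ) :
    ‖h⁻¹ • (x - y)‖ ≤ s ↔ ‖y - x‖ ≤ s * h := by
  rw [norm_smul, norm_inv, Real.norm_of_nonneg hh.le, norm_sub_rev, inv_mul_le_iff₀ hh, mul_comm]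

theorem ballCount_mul_le_sum_kernel {lam ρ h : ℝ} (hh : 0 < h)
    (hK : ∀ u, (Metric.closedBall 0 ρ).indicator (fun _ => lam) u ≤ K u) (x : F)
    (X : Fin n → F) : lam * ballCount x (ρ * h) X ≤ ∑ i, K (h⁻¹ • (x - X i)) := by
  classical
  rw [ballCount, Finset.mul_sum]
  refine Finset.sum_le_sum fun i _ => ?_
  refine le_trans (le_of_eq ?_) (hK (h⁻¹ • (x - X i)))
  simp only [Set.indicator_apply, mem_closedBall_iff_norm, sub_zero, mul_ite, mul_one, mul_zero,
    norm_inv_smul_sub_le_iff hh]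

theorem sum_kernelWeight {h : ℝ} {x : F} {X : Fin n → F}
    (hpos : 0 < ∑ i, K (h⁻¹ • (x - X i))) : ∑ j, kernelWeight K h x X j = 1 := by
  unfold kernelWeight
  rw [← Finset.sum_div, div_self hpos.ne']

/-- Each weight is at most the inverse of the kernel sum because `K ≤ 1`, and the weights add up to
1. -/
theorem sum_kernelWeight_sq_le (hK₀ : ∀ u, 0 ≤ K u) (hK₁ : ∀ u, K u ≤ 1) {h : ℝ} {x : F}
    {X : Fin n → F} (hpos : 0 < ∑ i, K (h⁻¹ • (x - X i))) :
    ∑ j, kernelWeight K h x X j ^ 2 ≤ (∑ i, K (h⁻¹ • (x - X i)))⁻¹ := by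
  calc ∑ j, kernelWeight K h x X j ^ 2
      ≤ ∑ j, (∑ i, K (h⁻¹ • (x - X i)))⁻¹ * kernelWeight K h x X j := by
        refine Finset.sum_le_sum fun j _ => ?_
        rw [sq]
        refine mul_le_mul_of_nonneg_right ?_ (kernelWeight_nonneg hK₀ h x X j)
        rw [kernelWeight, div_eq_mul_inv]
        exact mul_le_of_le_one_left (inv_nonneg.2 hpos.le) (hK₁ _)
    _ = (∑ i, K (h⁻¹ • (x - X i)))⁻¹ := by
        rw [← Finset.mul_sum, sum_kernelWeight hpos, mul_one]

theorem norm_sub_le_of_kernelWeight_ne_zero {R h : ℝ} (hh : 0 < h) (hK₀ : ∀ u, 0 ≤ K u)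
    (hK : ∀ u, K u ≤ (Metric.closedBall 0 R).indicator (fun _ => (1 : ℝ)) u) {x : F}
    {X : Fin n → F} {j : Fin n} (hj : kernelWeight K h x X j ≠ 0) : ‖X j - x‖ ≤ R * h := by
  rw [← norm_inv_smul_sub_le_iff hh]
  by_contra hlt
  refine hj ?_
  have hle := hK (h⁻¹ • (x - X j))
  rw [Set.indicator_of_notMem (by simpa using hlt)] at hle
  rw [kernelWeight, le_antisymm hle (hK₀ _), zero_div]

variable [MeasurableSpace F] [BorelSpace F]

theorem measurable_kernelWeight (hK : Measurable K) (h : ℝ) (x : F) (j : Fin n) :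
    Measurable fun X : Fin n → F => kernelWeight K h x X j := by
  have hm : ∀ i, Measurable fun X : Fin n → F => K (h⁻¹ • (x - X i)) := fun i =>
    (hK.comp (Continuous.measurable
      (by fun_prop : Continuous fun y : F => h⁻¹ • (x - y)))).comp (measurable_pi_apply i)
  exact (hm j).div (Finset.measurable_sum _ fun i _ => hm i)

theorem measurable_kernelEstimate (hK : Measurable K) (h : ℝ) (x : F) :
    Measurable fun p : (Fin n → F) × (Fin n → ℝ) => kernelEstimate K h x p.1 p.2 := by
  simp only [← sum_kernelWeight_mul]
  exact Finset.measurable_sum _ fun j _ =>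
    ((measurable_kernelWeight hK h x j).comp measurable_fst).mul
      ((measurable_pi_apply j).comp measurable_snd)

end Kernel

/-! ### Ball masses, bandwidth and choice of constants. -/

section Rates

open Filter

variable {F : Type*} [NormedAddCommGroup F] [MeasurableSpace F] {S : Set F} {x : F}
  {C d r τ L π₁ α β : ℝ} {P₀ P₁ : Measure F}

theorem IsHomogeneousModel.le_measureReal_closedBall (hC : 0 < C)
    (hmodel : IsHomogeneousModel S C d x r τ π₁ P₀ P₁) (hr : 0 < r) {s : ℝ} (hs : 0 < s)
    (hsr : s < r) :
    τ / C * (s / r) ^ d ≤ (marginalLaw π₁ P₀ P₁).real (Metric.closedBall x s) := by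
  have h := hmodel.mass.trans
    (hmodel.homogeneous r hr le_rfl (s / r) (by positivity) ((div_lt_one hr).2 hsr))
  rw [div_mul_cancel₀ _ hr.ne', Real.rpow_neg (by positivity)] at h
  have hpos : 0 < (s / r) ^ d := by positivity
  rw [div_mul_eq_mul_div, div_le_iff₀ hC]
  calc τ * (s / r) ^ d
      ≤ C * ((s / r) ^ d)⁻¹ * (marginalLaw π₁ P₀ P₁).real (Metric.closedBall x s) *
        (s / r) ^ d := by gcongr
    _ = (marginalLaw π₁ P₀ P₁).real (Metric.closedBall x s) * C := by field_simp

theorem rpow_bandwidth_sq {n : ℕ} :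
    ((n : ℝ) ^ (-(1 / (2 + d)))) ^ 2 = (n : ℝ) ^ (-(2 / (2 + d))) := by
  rw [← Real.rpow_natCast, ← Real.rpow_mul n.cast_nonneg]
  congr 1
  push_cast
  ring

/-- With `h = n^(-1/(2+d))` one has `n * h ^ d = n^(2/(2+d))`: the lower bound on the mass becomes
one on the expected count. -/
theorem IsHomogeneousModel.le_mul_measureReal_closedBall (hC : 0 < C) (hd : 1 ≤ d)
    (hmodel : IsHomogeneousModel S C d x r τ π₁ P₀ P₁) (hr : 0 < r) {n : ℕ} (hn : 0 < n) {s : ℝ}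
    (hs : 0 < s) (hsr : s * (n : ℝ) ^ (-(1 / (2 + d))) < r) :
    τ / C * (s / r) ^ d * (n : ℝ) ^ (2 / (2 + d)) ≤ n *
      (marginalLaw π₁ P₀ P₁).real (Metric.closedBall x (s * (n : ℝ) ^ (-(1 / (2 + d))))) := by
  have hn' : (0 : ℝ) < n := by exact_mod_cast hn
  have hball := hmodel.le_measureReal_closedBall hC hr (by positivity) hsr
  have hrate : (n : ℝ) ^ (2 / (2 + d)) = n * ((n : ℝ) ^ (-(1 / (2 + d)))) ^ d := by
    rw [← Real.rpow_mul hn'.le]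
    nth_rewrite 2 [← Real.rpow_one (n : ℝ)]
    rw [← Real.rpow_add hn']
    congr 1
    have : 2 + d ≠ 0 := by positivity
    field_simp
    ring
  rw [mul_div_right_comm, Real.mul_rpow (by positivity) (by positivity)] at hball
  calc τ / C * (s / r) ^ d * (n : ℝ) ^ (2 / (2 + d))
      = n * (τ / C * ((s / r) ^ d * ((n : ℝ) ^ (-(1 / (2 + d)))) ^ d)) := by rw [hrate]; ring
    _ ≤ _ := by gcongr

theorem tendsto_rpow_rate (hd : 1 ≤ d) :
    Tendsto (fun n : ℕ => (n : ℝ) ^ (2 / (2 + d))) atTop atTop :=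
  (tendsto_rpow_atTop (by positivity)).comp tendsto_natCast_atTop_atTop

theorem tendsto_rpow_bandwidth (hd : 1 ≤ d) (s : ℝ) :
    Tendsto (fun n : ℕ => s * (n : ℝ) ^ (-(1 / (2 + d)))) atTop (nhds 0) := by
  simpa using ((tendsto_rpow_neg_atTop (y := 1 / (2 + d)) (by positivity)).comp
    tendsto_natCast_atTop_atTop).const_mul s

/-- Ensures that the `n^(-1/2)` error of the class proportion does not exceed the order of the
bandwidth. -/
theorem one_le_mul_bandwidth_sq (hd : 1 ≤ d) {n : ℕ} (hn : 0 < n) :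
    1 ≤ n * ((n : ℝ) ^ (-(1 / (2 + d)))) ^ 2 := by
  have hn' : (0 : ℝ) < n := by exact_mod_cast hn
  rw [rpow_bandwidth_sq]
  nth_rewrite 1 [← Real.rpow_one (n : ℝ)]
  rw [← Real.rpow_add hn']
  refine Real.one_le_rpow (by exact_mod_cast hn) ?_
  have : 2 / (2 + d) ≤ 1 := by
    rw [div_le_one (by positivity)]
    linarith
  linarith

theorem rate_le_self (hd : 1 ≤ d) {n : ℕ} (hn : 0 < n) : (n : ℝ) ^ (2 / (2 + d)) ≤ n := by
  refine (Real.rpow_le_rpow_of_exponent_le (by exact_mod_cast hn) ?_).trans_eq (Real.rpow_one _)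
  rw [div_le_one (by positivity)]
  linarith

theorem mul_bandwidth_le_of_sq_le {κ δ : ℝ} {n : ℕ} (hκ : 0 ≤ κ)
    (h : κ ^ 2 * (n : ℝ) ^ (-(2 / (2 + d))) ≤ δ ^ 2) :
    κ * (n : ℝ) ^ (-(1 / (2 + d))) ≤ |δ| := by
  rw [← rpow_bandwidth_sq, ← mul_pow, ← sq_abs δ] at h
  exact (sq_le_sq₀ (by positivity) (abs_nonneg _)).1 h

theorem separationConstant_pos {L s₀ B₀ α β : ℝ} (hL : 0 ≤ L) (hs₀ : 0 ≤ s₀) :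
    0 < separationConstant L s₀ B₀ α β := by
  unfold separationConstant
  positivity

theorem kNN_type_two_error [BorelSpace F] (hx : x ∈ S) (hC : 0 < C) (hd : 1 ≤ d) (hr : 0 < r)
    (hτ : 0 < τ) (hL : 0 < L) (hπ₁ : π₁ ∈ Set.Icc (0 : ℝ) 1) (hα : α ∈ Set.Ioo (0 : ℝ) 1)
    (hβ : 0 < β) :
    ∃ C₁ : ℝ, 0 < C₁ ∧ ∃ N : ℕ, 0 < N ∧
      ∀ n k : ℕ, N ≤ n → |(k : ℝ) - (n : ℝ) ^ (2 / (2 + d))| < 1 →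
        ∀ (P₀ P₁ : Measure F) [IsProbabilityMeasure P₀] [IsProbabilityMeasure P₁] (m : F → ℝ),
          IsHomogeneousModel S C d x r τ π₁ P₀ P₁ → IsRegressionFunction π₁ P₀ P₁ m →
          m ∈ lipschitzAlternatives S L π₁ x (C₁ * (n : ℝ) ^ (-(2 / (2 + d)))) →
          (sampleLaw n π₁ P₀ P₁).real {z | ¬ Rejects α (kNNEstimate k x) z} ≤ β := by
  -- The radius at which the expected count is at least `4 * n^(2/(2+d))`, which exceeds `2 * k`
  -- once the rate is at least 2.
  set s₁ : ℝ := r * (4 * C / τ) ^ (1 / d) with hs₁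
  have hs₁0 : 0 < s₁ := by positivity
  have hs₁d : τ / C * (s₁ / r) ^ d = 4 := by
    rw [hs₁, mul_div_cancel_left₀ _ hr.ne', ← Real.rpow_mul (by positivity),
      one_div_mul_cancel (by positivity), Real.rpow_one]
    field_simp
  have hκ : 0 < separationConstant L s₁ 2 α β := separationConstant_pos hL.le hs₁0.le
  -- Since `k` is within 1 of the rate, the threshold `12 / β + 2` yields `6 / β ≤ k` and also `k ≥
  -- rate / 2`, whence `B₀ = 2`.
  obtain ⟨N, hN⟩ := eventually_atTop.1
    (((tendsto_rpow_rate hd).eventually_ge_atTop (12 / β + 2)).and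
      ((tendsto_rpow_bandwidth hd s₁).eventually_lt_const hr))
  refine ⟨separationConstant L s₁ 2 α β ^ 2, by positivity, max N 1, by positivity, ?_⟩
  intro n k hn hk P₀ P₁ _ _ m hmodel hm hmem
  obtain ⟨hrate, hband⟩ := hN n ((le_max_left _ _).trans hn)
  have hn0 : 0 < n := (le_max_right N 1).trans hn
  have hn' : (0 : ℝ) < n := by exact_mod_cast hn0
  obtain ⟨hk1, hk2⟩ := abs_lt.1 hk
  have hβ' : 0 < 12 / β := by positivity
  have hβ6 : 12 / β = 2 * (6 / β) := by ring
  have hk0 : 0 < k := by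
    have : (0 : ℝ) < k := by linarith
    exact_mod_cast this
  have hkn : k ≤ n := by
    have : (k : ℝ) < (n + 1 : ℕ) := by
      push_cast
      linarith [rate_le_self hd hn0]
    exact Nat.lt_succ_iff.1 (by exact_mod_cast this)
  have hmass := hmodel.le_mul_measureReal_closedBall hC hd hr hn0 hs₁0 hband
  rw [hs₁d] at hmass
  refine type_two_error_le (h := (n : ℝ) ^ (-(1 / (2 + d)))) (q := k) (B₀ := 2) (s₀ := s₁)
    (w := kNNWeight k x) hπ₁ hα.1 hα.2 hβ hn0 hx hL.le (by positivity)
    (one_le_mul_bandwidth_sq hd hn0) two_pos (by linarith) (by linarith) hmodel.carried hm hmem.1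
    (mul_bandwidth_le_of_sq_le hκ.le hmem.2) (measurable_kNNWeight k x)
    (kNNWeight_nonneg k x) (fun X Y => (sum_kNNWeight_mul k x X Y).symm)
    (fun X _ => sum_kNNWeight hk0 hkn x X) (fun X _ => ?_)
    (fun X hX j hj => norm_sub_le_of_kNNWeight_ne_zero hX hj)
  rw [sum_kNNWeight_sq hk0 hkn, rpow_bandwidth_sq, Real.rpow_neg hn'.le]
  calc (k : ℝ)⁻¹ ≤ ((n : ℝ) ^ (2 / (2 + d)) / 2)⁻¹ :=
        inv_anti₀ (by positivity) (by linarith)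
    _ = 2 * ((n : ℝ) ^ (2 / (2 + d)))⁻¹ := by rw [inv_div]; rfl

theorem kernel_type_two_error [NormedSpace ℝ F] [BorelSpace F] (hx : x ∈ S) (hC : 0 < C)
    (hd : 1 ≤ d) (hr : 0 < r) (hτ : 0 < τ) (hL : 0 < L) (hπ₁ : π₁ ∈ Set.Icc (0 : ℝ) 1)
    (hα : α ∈ Set.Ioo (0 : ℝ) 1) (hβ : 0 < β) {K : F → ℝ} {ρ R lam : ℝ} (hK : Measurable K)
    (hρ : 0 < ρ) (hR : 0 < R) (hlam : 0 < lam)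
    (hKl : ∀ u, (Metric.closedBall 0 ρ).indicator (fun _ => lam) u ≤ K u)
    (hKu : ∀ u, K u ≤ (Metric.closedBall 0 R).indicator (fun _ => (1 : ℝ)) u) :
    ∃ C₁ : ℝ, 0 < C₁ ∧ ∃ N : ℕ, 0 < N ∧
      ∀ n : ℕ, N ≤ n →
        ∀ (P₀ P₁ : Measure F) [IsProbabilityMeasure P₀] [IsProbabilityMeasure P₁] (m : F → ℝ),
          IsHomogeneousModel S C d x r τ π₁ P₀ P₁ → IsRegressionFunction π₁ P₀ P₁ m →
          m ∈ lipschitzAlternatives S L π₁ x (C₁ * (n : ℝ) ^ (-(2 / (2 + d)))) →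
          (sampleLaw n π₁ P₀ P₁).real
            {z | ¬ Rejects α (kernelEstimate K ((n : ℝ) ^ (-(1 / (2 + d)))) x) z} ≤ β := by
  -- Half the constant in the expected count, so that `q = c₀ * n^(2/(2+d))` satisfies the
  -- requirement on `2 * q`.
  set c₀ : ℝ := τ / C * (ρ / r) ^ d / 2 with hc₀
  have hc₀0 : 0 < c₀ := by positivity
  -- At least `q` points in the inner ball make the kernel sum at least `lam * q`, whose inverse is
  -- `B₀ * h ^ 2`.
  set B₀ : ℝ := (lam * c₀)⁻¹ with hB₀
  have hB₀0 : 0 < B₀ := by positivity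
  have hK₀ : ∀ u, 0 ≤ K u := fun u =>
    (Set.indicator_nonneg (fun _ _ => hlam.le) u).trans (hKl u)
  have hK₁ : ∀ u, K u ≤ 1 := fun u =>
    (hKu u).trans (Set.indicator_le_self' (fun _ _ => zero_le_one) u)
  have hκ : 0 < separationConstant L R B₀ α β := separationConstant_pos hL.le hR.le
  obtain ⟨N, hN⟩ := eventually_atTop.1
    (((tendsto_rpow_rate hd).eventually_ge_atTop (6 / β / c₀)).and
      ((tendsto_rpow_bandwidth hd ρ).eventually_lt_const hr))
  refine ⟨separationConstant L R B₀ α β ^ 2, by positivity, max N 1, by positivity, ?_⟩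
  intro n hn P₀ P₁ _ _ m hmodel hm hmem
  obtain ⟨hrate, hband⟩ := hN n ((le_max_left _ _).trans hn)
  have hn0 : 0 < n := (le_max_right N 1).trans hn
  have hn' : (0 : ℝ) < n := by exact_mod_cast hn0
  set h : ℝ := (n : ℝ) ^ (-(1 / (2 + d))) with hh
  have hh0 : 0 < h := by positivity
  set q : ℝ := c₀ * (n : ℝ) ^ (2 / (2 + d)) with hq
  have hq0 : 0 < q := by positivity
  have hmass := hmodel.le_mul_measureReal_closedBall hC hd hr hn0 hρ hband
  have hsum : ∀ X : Fin n → F, q ≤ ballCount x (ρ * h) X →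
      lam * q ≤ ∑ i, K (h⁻¹ • (x - X i)) := fun X hX =>
    (mul_le_mul_of_nonneg_left hX hlam.le).trans (ballCount_mul_le_sum_kernel hh0 hKl x X)
  have hsum0 : ∀ X : Fin n → F, q ≤ ballCount x (ρ * h) X →
      0 < ∑ i, K (h⁻¹ • (x - X i)) := fun X hX => (mul_pos hlam hq0).trans_le (hsum X hX)
  refine type_two_error_le (h := h) (s := ρ * h) (q := q) (B₀ := B₀) (s₀ := R)
    (w := kernelWeight K h x) hπ₁ hα.1 hα.2 hβ hn0 hx hL.le hh0
    (one_le_mul_bandwidth_sq hd hn0) hB₀0 ?_ (le_of_eq_of_le ?_ hmass) hmodel.carried hm hmem.1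
    (mul_bandwidth_le_of_sq_le hκ.le hmem.2) (measurable_kernelWeight hK h x)
    (kernelWeight_nonneg hK₀ h x) (fun X Y => (sum_kernelWeight_mul h x X Y).symm)
    (fun X hX => sum_kernelWeight (hsum0 X hX)) (fun X hX => ?_)
    (fun X _ j hj => norm_sub_le_of_kernelWeight_ne_zero hh0 hK₀ hKu hj)
  · rw [div_le_iff₀ hc₀0] at hrate
    linarith
  · rw [hq, hc₀]
    ring
  · refine (sum_kernelWeight_sq_le hK₀ hK₁ (hsum0 X hX)).trans
      ((inv_anti₀ (by positivity) (hsum X hX)).trans_eq ?_)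
    rw [hh, rpow_bandwidth_sq, Real.rpow_neg hn'.le, hq, hB₀, ← mul_inv, mul_assoc]

end Rates

end LocalRegressionTest

end

/-! ### Level and power of the two tests. -/

open LocalRegressionTest in
theorem proposition1 {D : ℕ} (S : Set (EuclideanSpace ℝ (Fin D))) (x : EuclideanSpace ℝ (Fin D))
    (hx : x ∈ S) (C d r τ L π₁ α β : ℝ) (hC : 0 < C) (hd : 1 ≤ d) (hdD : d < D) (hr : 0 < r)
    (hτ : 0 < τ) (hL : 0 < L) (hπ₁ : π₁ ∈ Set.Ioo (0 : ℝ) 1) (hα : α ∈ Set.Ioo (0 : ℝ) 1)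
    (hβ : β ∈ Set.Ioo (0 : ℝ) (1 - α)) :
    -- the kNN test
    (∃ C₁ : ℝ, 0 < C₁ ∧ ∃ N : ℕ, 0 < N ∧
      -- type I error
      (∀ n k : ℕ, |(k : ℝ) - (n : ℝ) ^ (2 / (2 + d))| < 1 →
        ∀ (P₀ P₁ : Measure (EuclideanSpace ℝ (Fin D))) [IsProbabilityMeasure P₀]
          [IsProbabilityMeasure P₁] (m : EuclideanSpace ℝ (Fin D) → ℝ),
          marginalLaw π₁ P₀ P₁ Sᶜ = 0 → IsRegressionFunction π₁ P₀ P₁ m →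
          m ∈ nullClass S π₁ →
          (sampleLaw n π₁ P₀ P₁).real {z | Rejects α (kNNEstimate k x) z} ≤ α) ∧
      -- type II error
      (∀ n k : ℕ, N ≤ n → |(k : ℝ) - (n : ℝ) ^ (2 / (2 + d))| < 1 →
        ∀ (P₀ P₁ : Measure (EuclideanSpace ℝ (Fin D))) [IsProbabilityMeasure P₀]
          [IsProbabilityMeasure P₁] (m : EuclideanSpace ℝ (Fin D) → ℝ),
          IsHomogeneousModel S C d x r τ π₁ P₀ P₁ → IsRegressionFunction π₁ P₀ P₁ m →
          m ∈ lipschitzAlternatives S L π₁ x (C₁ * (n : ℝ) ^ (-(2 / (2 + d)))) →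
          (sampleLaw n π₁ P₀ P₁).real {z | ¬ Rejects α (kNNEstimate k x) z} ≤ β)) ∧
    -- the kernel test
    (∀ (K : EuclideanSpace ℝ (Fin D) → ℝ) (ρ R lam : ℝ), Measurable K → 0 < ρ → ρ < R →
      0 < lam → lam < 1 →
      (∀ u, (Metric.closedBall 0 ρ).indicator (fun _ => lam) u ≤ K u) →
      (∀ u, K u ≤ (Metric.closedBall 0 R).indicator (fun _ => (1 : ℝ)) u) →
      ∃ C₁ : ℝ, 0 < C₁ ∧ ∃ N : ℕ, 0 < N ∧
        -- type I error
        (∀ n : ℕ,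
          ∀ (P₀ P₁ : Measure (EuclideanSpace ℝ (Fin D))) [IsProbabilityMeasure P₀]
            [IsProbabilityMeasure P₁] (m : EuclideanSpace ℝ (Fin D) → ℝ),
            marginalLaw π₁ P₀ P₁ Sᶜ = 0 → IsRegressionFunction π₁ P₀ P₁ m →
            m ∈ nullClass S π₁ →
            (sampleLaw n π₁ P₀ P₁).real
              {z | Rejects α (kernelEstimate K ((n : ℝ) ^ (-(1 / (2 + d)))) x) z} ≤ α) ∧
        -- type II error
        (∀ n : ℕ, N ≤ n →
          ∀ (P₀ P₁ : Measure (EuclideanSpace ℝ (Fin D))) [IsProbabilityMeasure P₀]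
            [IsProbabilityMeasure P₁] (m : EuclideanSpace ℝ (Fin D) → ℝ),
            IsHomogeneousModel S C d x r τ π₁ P₀ P₁ → IsRegressionFunction π₁ P₀ P₁ m →
            m ∈ lipschitzAlternatives S L π₁ x (C₁ * (n : ℝ) ^ (-(2 / (2 + d)))) →
            (sampleLaw n π₁ P₀ P₁).real
              {z | ¬ Rejects α (kernelEstimate K ((n : ℝ) ^ (-(1 / (2 + d)))) x) z} ≤ β)) := by

  have hπ : π₁ ∈ Set.Icc (0 : ℝ) 1 := ⟨hπ₁.1.le, hπ₁.2.le⟩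
  refine ⟨?_, ?_⟩
  · obtain ⟨C₁, hC₁, N, hN, htwo⟩ := kNN_type_two_error hx hC hd hr hτ hL hπ hα hβ.1
    exact ⟨C₁, hC₁, N, hN, fun n k _ P₀ P₁ _ _ m hS hm hnull =>
      type_one_error_le hπ₁ hα.1.le hα.2 (measurable_kNNEstimate k x) hS hm hnull, htwo⟩
  · intro K ρ R lam hK hρ hρR hlam _ hKl hKu
    obtain ⟨C₁, hC₁, N, hN, htwo⟩ := kernel_type_two_error hx hC hd hr hτ hL hπ hα hβ.1 hK hρ
      (hρ.trans hρR) hlam hKl hKu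
    exact ⟨C₁, hC₁, N, hN, fun n P₀ P₁ _ _ m hS hm hnull =>
      type_one_error_le hπ₁ hα.1.le hα.2 (measurable_kernelEstimate hK _ x) hS hm hnull, htwo⟩
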